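/- A lattice in $\mathbb{R}^n$ is the set $L$ of integer linear combinations of a basis $v_1,\dots,v_n$ of $\mathbb{R}^n$. It is called unimodular if $(x,y)\in\mathbb{Z}$ for all $x,y\in L$ and its Gram matrix $((v_i,v_j))_{i,j}$ has determinant $1$; it is even if $(x,x)\in 2\mathbb{Z}$ for all $x\in L$. The norm of $x\in L$ is $(x,x)$, and a root of $L$ is a vector of $L$ of norm $1$ or $2$. A parity vector of a unimodular lattice $L$ is a vector $u\in L$ with $(u,x)\equiv(x,x)\pmod 2$ for all $x\in L$. Two lattices in $\mathbb{R}^n$ are equivalent if some linear isometry of $\mathbb{R}^n$ maps one onto the other, and $\mathrm{Aut}(L)$ is the group of linear isometries of $\mathbb{R}^n$ mapping $L$ onto itself. The mass of a family of lattices closed under equivalence is $\sum_L 1/|\mathrm{Aut}(L)|$, where $L$ runs over representatives of the equivalence classes in the family. Let $m_{32}^{\mathrm{II}}(\emptyset)$ be the mass of the $32$-dimensional even unimodular lattices with no roots. Then the mass of the $31$-dimensional unimodular lattices with no roots and with no parity vectors of norm $7$ is $$\frac{146880}{2}\; m_{32}^{\mathrm{II}}(\emptyset).$$ -/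

import Mathlib

open scoped ENNReal

namespace UnimodularLattice

/-- Euclidean `n`-space. -/
abbrev E (n : ℕ) : Type := EuclideanSpace ℝ (Fin n)

/-- `b` is an integral basis of `L`: a basis of `ℝⁿ` whose integer linear combinations are exactly
the elements of `L`. -/
def IsIntegralBasis {n : ℕ} (L : Submodule ℤ (E n)) (b : Module.Basis (Fin n) ℝ (E n)) : Prop :=
  L = Submodule.span ℤ (Set.range b)

/-- All inner products of elements of `L` are integers. -/
def IsIntegral {n : ℕ} (L : Submodule ℤ (E n)) : Prop :=
  ∀ x ∈ L, ∀ y ∈ L, ∃ k : ℤ, inner ℝ x y = (k : ℝ)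

/-- `L` is an `n`-dimensional (integral) unimodular lattice: it has an integral basis, it is
integral, and its Gram determinant is `1`. (The determinant does not depend on the basis.) -/
def IsUnimodular {n : ℕ} (L : Submodule ℤ (E n)) : Prop :=
  IsIntegral L ∧
    ∃ b : Module.Basis (Fin n) ℝ (E n), IsIntegralBasis L b ∧ (Matrix.gram ℝ b).det = 1

/-- All norms `(x, x)` of elements of `L` are even integers. -/
def IsEven {n : ℕ} (L : Submodule ℤ (E n)) : Prop :=
  ∀ x ∈ L, ∃ k : ℤ, inner ℝ x x = 2 * (k : ℝ)

/-- The roots of `L`: its vectors of norm `1` or `2`, where the norm of `x` is `(x, x)`. -/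
def roots {n : ℕ} (L : Submodule ℤ (E n)) : Set (E n) :=
  {x | x ∈ L ∧ (inner ℝ x x = (1 : ℝ) ∨ inner ℝ x x = (2 : ℝ))}

/-- `u` is a parity (characteristic) vector of `L`: `u ∈ L` and `(u, x) ≡ (x, x) (mod 2)` for all
`x ∈ L`. -/
def IsParityVector {n : ℕ} (L : Submodule ℤ (E n)) (u : E n) : Prop :=
  u ∈ L ∧ ∀ x ∈ L, ∃ k : ℤ, inner ℝ u x - inner ℝ x x = 2 * (k : ℝ)

/-- Two lattices in `ℝⁿ` are equivalent if a linear isometry of `ℝⁿ` takes one onto the other;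
in terms of Gram matrices, `Xᵀ B X = A` for an integral matrix `X` of determinant `±1`. -/
def Equivalent {n : ℕ} (L M : Submodule ℤ (E n)) : Prop :=
  ∃ g : E n ≃ₗᵢ[ℝ] E n, g '' (L : Set (E n)) = (M : Set (E n))

/-- Equivalence as an equivalence relation on the lattices having a given property. -/
def equivSetoid {n : ℕ} (P : Submodule ℤ (E n) → Prop) : Setoid {L : Submodule ℤ (E n) // P L} where
  r L M := Equivalent L.1 M.1
  iseqv :=
    { refl := fun L => ⟨LinearIsometryEquiv.refl ℝ (E n), by simp⟩
      symm := by
        rintro L M ⟨g, hg⟩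
        refine ⟨g.symm, ?_⟩
        rw [← hg, ← Set.image_comp]
        simp
      trans := by
        rintro L M N ⟨g, hg⟩ ⟨h, hh⟩
        refine ⟨g.trans h, ?_⟩
        rw [← hh, ← hg, ← Set.image_comp]
        rfl }

/-- The automorphism group of `L`: the linear isometries of `ℝⁿ` taking `L` onto itself. -/
def Aut {n : ℕ} (L : Submodule ℤ (E n)) : Subgroup (E n ≃ₗᵢ[ℝ] E n) where
  carrier := {g | g '' (L : Set (E n)) = (L : Set (E n))}
  one_mem' := by simp
  mul_mem' := by
    intro g h hg hh
    simp only [Set.mem_ofPred_eq] at hg hh ⊢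
    rw [LinearIsometryEquiv.coe_mul, Set.image_comp, hh, hg]
  inv_mem' := by
    intro g hg
    simp only [Set.mem_ofPred_eq] at hg ⊢
    rw [LinearIsometryEquiv.coe_inv]
    conv_lhs => rw [← hg]
    rw [← Set.image_comp]
    simp

/-- The mass of the lattices in `ℝⁿ` with property `P`: the sum of `1 / |Aut L|`, where `L` runs
through representatives of the equivalence classes of the lattices with property `P`. It takes
values in `[0, ∞]`, so that the sum makes sense unconditionally. -/
noncomputable def mass {n : ℕ} (P : Submodule ℤ (E n) → Prop) : ℝ≥0∞ :=
  ∑' c : Quotient (equivSetoid P), ((Nat.card (Aut c.out.1) : ℝ≥0∞))⁻¹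

/-- The mass of the even unimodular lattices of dimension `n` whose root system is empty. -/
noncomputable def massEvenNoRoots (n : ℕ) : ℝ≥0∞ :=
  mass fun L : Submodule ℤ (E n) => IsUnimodular L ∧ IsEven L ∧ roots L = ∅

end UnimodularLattice

/-! Count in two ways the mass of pairs (M, v), where M is a 32-dimensional even unimodular lattice
without roots and v ∈ M has norm 4, under the action of the orthogonal group.

Fix M first. Its theta series is a modular form of weight 16 for the full modular group, and the
space of these has dimension 2. Having no roots means that the series starts 1 + 0q, so its
q²-coefficient, the number of vectors of norm 4, is forced to be 146880 (`card_norm_four_eq`). The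
mass of pairs is therefore 146880 times the mass of the lattices M (`mass_pointedFamily`).

Fix v first. The orthogonal group is transitive on vectors of norm 4, so v may be taken to be (0, 2)
in V ⊕ ℝ with dim V = 31, leaving the orthogonal group of V (`mass_gluedFamily`). Project to V the
vectors of M whose product with v is even, that is, whose last coordinate is an integer. The result
is a unimodular lattice L = `slice M`. Conversely, M consists of the even sublattice of L ⊕ ℤ
together with half of (u, 1), where u is a parity vector of L. This half vector has norm ((u, u) +
1)/4, an even integer because (u, u) ≡ -1 mod 8, which is again proved with theta series. The
choices u and -u give exactly two lattices M over each L (`card_glued_fiber`).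

Under this correspondence M has no roots exactly when L has no roots and no parity vector of norm 7:
a root of M with half-integral last coordinate is half of (u, ±1) with (u, u) = 7. Hence twice the
desired mass is 146880 times the mass of the lattices M. -/

namespace UnimodularLattice

/-! ### Self-dual lattices and their agreement with unimodular ones -/

variable {V : Type*} [NormedAddCommGroup V] [InnerProductSpace ℝ V]

/-- `L` coincides with its dual lattice. -/
def IsSelfDual (L : Submodule ℤ V) : Prop :=
  ∀ x, x ∈ L ↔ ∀ y ∈ L, ∃ k : ℤ, inner ℝ x y = (k : ℝ)

namespace IsSelfDual

variable {L : Submodule ℤ V}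

theorem exists_inner_eq (hL : IsSelfDual L) {x y : V} (hx : x ∈ L) (hy : y ∈ L) :
    ∃ k : ℤ, inner ℝ x y = (k : ℝ) :=
  (hL x).1 hx y hy

theorem one_le_norm (hL : IsSelfDual L) {x : V} (hx : x ∈ L) (h0 : x ≠ 0) : 1 ≤ ‖x‖ := by
  obtain ⟨k, hk⟩ := hL.exists_inner_eq hx hx
  rw [real_inner_self_eq_norm_sq] at hk
  have h1 : (0 : ℝ) < k := by
    rw [← hk]
    have := norm_pos_iff.2 h0
    positivity
  have h2 : (1 : ℝ) ≤ k := by exact_mod_cast Int.cast_pos.1 h1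
  rw [← hk] at h2
  nlinarith [norm_nonneg x]

theorem discreteTopology (hL : IsSelfDual L) : DiscreteTopology L := by
  refine discreteTopology_iff_isOpen_singleton_zero.mpr ⟨Metric.ball 0 1, Metric.isOpen_ball, ?_⟩
  ext x
  simp only [Set.mem_preimage, mem_ball_zero_iff, Set.mem_singleton_iff]
  constructor
  · intro h
    by_contra h0
    exact absurd (hL.one_le_norm x.2 (by simpa using h0)) (not_le.2 h)
  · rintro rfl
    simp

/-- A vector orthogonal to L has integral (zero) products with L, so it lies in L and is orthogonal
to itself. -/
theorem span_eq_top (hL : IsSelfDual L) [FiniteDimensional ℝ V] :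
    Submodule.span ℝ (L : Set V) = ⊤ := by
  rw [← Submodule.orthogonal_eq_bot_iff, Submodule.eq_bot_iff]
  intro x hx
  rw [Submodule.mem_orthogonal'] at hx
  have hxL : x ∈ L := (hL x).2 fun y hy => ⟨0, by simpa using hx y (Submodule.subset_span hy)⟩
  exact inner_self_eq_zero.1 (hx x (Submodule.subset_span hxL))

theorem isZLattice (hL : IsSelfDual L) [FiniteDimensional ℝ V] [DiscreteTopology L] :
    IsZLattice ℝ L :=
  ⟨hL.span_eq_top⟩

theorem exists_basis (hL : IsSelfDual L) [FiniteDimensional ℝ V] {n : ℕ}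
    (hn : Module.finrank ℝ V = n) :
    ∃ b : Module.Basis (Fin n) ℝ V, L = Submodule.span ℤ (Set.range b) := by
  have := hL.discreteTopology
  have := hL.isZLattice
  have : Module.Finite ℤ L := ZLattice.module_finite ℝ L
  have : Module.Free ℤ L := ZLattice.module_free ℝ L
  let b := (Module.finBasisOfFinrankEq ℤ L ((ZLattice.rank ℝ L).trans hn))
  exact ⟨b.ofZLatticeBasis ℝ, (b.ofZLatticeBasis_span ℝ).symm⟩

end IsSelfDual

theorem exists_inner_basis_eq {ι : Type*} [Fintype ι] (b : Module.Basis ι ℝ V) (c : ι → ℝ) :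
    ∃ x, ∀ i, inner ℝ x (b i) = c i := by
  have : FiniteDimensional ℝ V := b.finiteDimensional_of_finite
  let f : V →ₗ[ℝ] (ι → ℝ) := LinearMap.pi fun i => (innerₗ V (b i))
  have hf : Function.Injective f := by
    rw [injective_iff_map_eq_zero]
    intro x hx
    refine InnerProductSpace.ext_inner_left_basis b fun i => ?_
    simpa [f] using congrFun hx i
  have hs : Function.Surjective f :=
    (LinearMap.injective_iff_surjective_of_finrank_eq_finrank
      (by simp [Module.finrank_eq_card_basis b])).1 hf
  obtain ⟨x, hx⟩ := hs c
  exact ⟨x, fun i => by simpa [f, real_inner_comm] using congrFun hx i⟩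

theorem exists_inner_span_eq {ι : Type*} [Fintype ι] (b : ι → V) (x : V)
    (h : ∀ i, ∃ k : ℤ, inner ℝ x (b i) = (k : ℝ)) {y : V}
    (hy : y ∈ Submodule.span ℤ (Set.range b)) : ∃ k : ℤ, inner ℝ x y = (k : ℝ) := by
  induction hy using Submodule.span_induction with
  | mem y hy => obtain ⟨i, rfl⟩ := hy; exact h i
  | zero => exact ⟨0, by simp⟩
  | add y z _ _ h1 h2 =>
    obtain ⟨k, hk⟩ := h1
    obtain ⟨l, hl⟩ := h2
    exact ⟨k + l, by rw [inner_add_right, hk, hl]; push_cast; ring⟩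
  | smul a y _ h1 =>
    obtain ⟨k, hk⟩ := h1
    exact ⟨a * k, by
      rw [← Int.cast_smul_eq_zsmul ℝ, inner_smul_right, hk]; push_cast; ring⟩

variable {n : ℕ}

/-- Cramer's rule: the coordinates of x are the adjugate of the integral Gram matrix applied to the
integers (x, bᵢ), with no denominator since the determinant is 1. -/
theorem IsUnimodular.isSelfDual {L : Submodule ℤ (E n)} (hL : IsUnimodular L) : IsSelfDual L := by
  obtain ⟨h_integral, b, hb, hdet⟩ := hL
  refine fun x => ⟨fun hx y hy => h_integral x hx y hy, fun h => ?_⟩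
  have hbL : ∀ i, b i ∈ L := fun i => by
    rw [show L = _ from hb]; exact Submodule.subset_span ⟨i, rfl⟩
  choose G hG using fun i j => h_integral (b i) (hbL i) (b j) (hbL j)
  choose k hk using fun i => h (b i) (hbL i)
  have hGm : Matrix.gram ℝ b = (Matrix.of G).map (Int.castRingHom ℝ) := by
    ext i j; simp [hG]
  have hdet' : (Matrix.of G).det = 1 := by
    rw [hGm, ← RingHom.mapMatrix_apply, ← RingHom.map_det] at hdet
    simpa using hdet
  have h1 : (Matrix.gram ℝ b).mulVec (b.repr x) = fun i => (k i : ℝ) := by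
    ext i
    rw [← hk i, real_inner_comm]
    conv_rhs => rw [← b.sum_repr x, inner_sum]
    simp [Matrix.mulVec, dotProduct, inner_smul_right, mul_comm]
  have h2 : (b.repr x : Fin n → ℝ) = fun i => (((Matrix.of G).adjugate.mulVec k i : ℤ) : ℝ) := by
    have : (Matrix.gram ℝ b).adjugate.mulVec ((Matrix.gram ℝ b).mulVec (b.repr x)) = b.repr x := by
      rw [Matrix.mulVec_mulVec, Matrix.adjugate_mul, hdet, one_smul, Matrix.one_mulVec]
    rw [← this, h1, hGm, ← RingHom.mapMatrix_apply, ← RingHom.map_adjugate]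
    ext i
    simp [Matrix.mulVec, dotProduct]
  rw [show L = _ from hb, b.mem_span_iff_repr_mem ℤ]
  intro i
  exact ⟨_, (congrFun h2 i).symm⟩

/-- The dual basis lies in L, so its coordinates form an integral inverse of the Gram matrix. The
determinant is then ±1, and positive definiteness decides the sign. -/
theorem IsSelfDual.isUnimodular {L : Submodule ℤ (E n)} (hL : IsSelfDual L) : IsUnimodular L := by
  refine ⟨fun x hx y hy => hL.exists_inner_eq hx hy, ?_⟩
  obtain ⟨b, hb⟩ := hL.exists_basis (n := n) (by simp)
  refine ⟨b, hb, ?_⟩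
  have hbL : ∀ i, b i ∈ L := fun i => by
    rw [hb]; exact Submodule.subset_span ⟨i, rfl⟩
  choose G hG using fun i j => hL.exists_inner_eq (hbL i) (hbL j)
  choose d hd using fun j : Fin n => exists_inner_basis_eq b (Pi.single j 1)
  have hdL : ∀ j, d j ∈ L := fun j => (hL _).2 fun y hy => by
    rw [hb] at hy
    refine exists_inner_span_eq b (d j) (fun i => ⟨(Pi.single j 1 : Fin n → ℤ) i, ?_⟩) hy
    rw [hd]
    by_cases h : i = j <;> simp [h]
  have hrep : ∀ j i, ∃ k : ℤ, (k : ℝ) = b.repr (d j) i := fun j i => by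
    have := hdL j
    rw [hb, b.mem_span_iff_repr_mem ℤ] at this
    simpa using this i
  choose H hH using hrep
  have hHG : Matrix.of H * Matrix.of G = 1 := by
    ext j i
    have : inner ℝ (d j) (b i) = ∑ l, (H j l : ℝ) * G l i := by
      conv_lhs => rw [← b.sum_repr (d j), sum_inner]
      simp [inner_smul_left, hH, hG]
    rw [hd] at this
    rw [Matrix.mul_apply]
    have h3 : ((∑ l, H j l * G l i : ℤ) : ℝ) = ((1 : Matrix (Fin n) (Fin n) ℤ) j i : ℝ) := by
      push_cast
      rw [← this, Matrix.one_apply, Pi.single_apply]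
      by_cases h : j = i <;> simp [h, eq_comm]
    exact_mod_cast h3
  have hGm : Matrix.gram ℝ b = (Matrix.of G).map (Int.castRingHom ℝ) := by
    ext i j; simp [hG]
  have hdet : (Matrix.gram ℝ b).det = ((Matrix.of G).det : ℝ) := by
    rw [hGm, ← RingHom.mapMatrix_apply, ← RingHom.map_det]; simp
  have hpos : 0 < (Matrix.gram ℝ b).det :=
    (Matrix.posDef_gram_of_linearIndependent b.linearIndependent).det_pos
  have hunit : IsUnit (Matrix.of G).det := by
    refine IsUnit.of_mul_eq_one (Matrix.of H).det ?_
    rw [mul_comm, ← Matrix.det_mul, hHG, Matrix.det_one]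
  rw [hdet] at hpos ⊢
  rcases Int.isUnit_iff.1 hunit with h | h
  · rw [h]; simp
  · rw [h] at hpos; norm_num at hpos

theorem isUnimodular_iff_isSelfDual {L : Submodule ℤ (E n)} : IsUnimodular L ↔ IsSelfDual L :=
  ⟨IsUnimodular.isSelfDual, IsSelfDual.isUnimodular⟩

/-- Vectors of bounded length in a self-dual lattice are finite in number. -/
theorem IsSelfDual.finite_norm_le [FiniteDimensional ℝ V] {L : Submodule ℤ V} (hL : IsSelfDual L)
    (r : ℝ) : {x | x ∈ L ∧ ‖x‖ ≤ r}.Finite := by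
  obtain ⟨b, hb⟩ := hL.exists_basis rfl
  refine (ZSpan.setFinite_inter b (s := Metric.closedBall 0 r) Metric.isBounded_closedBall).subset ?_
  rintro x ⟨hx, hr⟩
  exact ⟨by simpa using hr, by rw [← hb]; exact hx⟩

end UnimodularLattice

/-! ### Masses of group actions -/

/-- The mass of a group action: the sum over the orbits of the reciprocals of the orders of the
stabilizers. -/
noncomputable def MulAction.mass (G X : Type*) [Group G] [MulAction G X] : ℝ≥0∞ :=
  ∑' c : MulAction.orbitRel.Quotient G X, ((Nat.card (MulAction.stabilizer G c.out) : ℝ≥0∞))⁻¹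

namespace MulAction

variable {G X Y : Type*} [Group G] [MulAction G X] [MulAction G Y]

theorem card_stabilizer_eq_of_orbitRel {x y : X} (h : MulAction.orbitRel G X x y) :
    Nat.card (stabilizer G x) = Nat.card (stabilizer G y) :=
  Nat.card_congr (stabilizerEquivStabilizerOfOrbitRel h).toEquiv

theorem card_stabilizer_out (x : X) :
    Nat.card (stabilizer G (Quotient.mk (orbitRel G X) x).out) = Nat.card (stabilizer G x) :=
  card_stabilizer_eq_of_orbitRel (Quotient.mk_out (s := orbitRel G X) x)

/-- The part of the orbit `c` lying over x is a single orbit of the stabilizer of x, and the point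
stabilizers there are those in G; apply orbit-stabilizer. -/
theorem card_fiber_inter_orbit (f : Y → X) (hf : ∀ (g : G) y, f (g • y) = g • f y) (x : X)
    [Finite (stabilizer G x)] (c : orbitRel.Quotient G Y)
    (hc : (Quotient.mk (orbitRel G X) (f c.out)) = Quotient.mk (orbitRel G X) x) :
    Nat.card {y // f y = x ∧ Quotient.mk (orbitRel G Y) y = c} *
      Nat.card (stabilizer G c.out) = Nat.card (stabilizer G x) := by
  obtain ⟨g₀, hg₀⟩ : ∃ g₀ : G, g₀ • f c.out = x := by
    have := Quotient.exact hc.symm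
    obtain ⟨g, hg⟩ := this
    exact ⟨g, hg⟩
  set y₀ := g₀ • c.out with hy₀
  have hfy : f y₀ = x := by rw [hy₀, hf, hg₀]
  have hcy : Quotient.mk (orbitRel G Y) y₀ = c := by
    conv_rhs => rw [← Quotient.out_eq c]
    exact Quotient.sound ⟨g₀, rfl⟩
  have hst : Nat.card (stabilizer G c.out) = Nat.card (stabilizer G y₀) :=
    (card_stabilizer_eq_of_orbitRel ⟨g₀, rfl⟩).symm
  have hle : stabilizer G y₀ ≤ stabilizer G x := fun g hg => by
    rw [mem_stabilizer_iff] at hg ⊢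
    rw [← hfy, ← hf, hg]
  let S := stabilizer G x
  have horb : Nat.card {y // f y = x ∧ Quotient.mk (orbitRel G Y) y = c} =
      Nat.card (orbit S y₀) := by
    refine Nat.card_congr (Equiv.subtypeEquivRight fun y => ⟨?_, ?_⟩)
    · rintro ⟨h1, h2⟩
      rw [← hcy] at h2
      obtain ⟨g, hg⟩ := Quotient.exact h2
      refine ⟨⟨g, ?_⟩, hg⟩
      rw [mem_stabilizer_iff]
      conv_lhs => rw [← hfy, ← hf, show g • y₀ = y from hg, h1]
    · rintro ⟨g, rfl⟩
      refine ⟨?_, ?_⟩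
      · change f ((g : G) • y₀) = x
        rw [hf, hfy]; exact g.2
      · rw [← hcy]; exact Quotient.sound ⟨g, rfl⟩
  have hstab : Nat.card (stabilizer G y₀) = Nat.card (stabilizer S y₀) :=
    Nat.card_congr
      { toFun := fun g => ⟨⟨g, hle g.2⟩, g.2⟩
        invFun := fun g => ⟨g.1, g.2⟩
        left_inv := fun _ => rfl
        right_inv := fun _ => rfl }
  rw [hst, horb, hstab]
  have := Nat.card_congr (orbitProdStabilizerEquivGroup S y₀)
  rwa [Nat.card_prod] at this

/-- If all fibres of an equivariant map have `N` elements, the masses differ by the factor `N`. -/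
theorem mass_eq_mul_of_card_fiber (f : Y → X) (hf : ∀ (g : G) y, f (g • y) = g • f y)
    (hfin : ∀ x : X, Finite (stabilizer G x)) (N : ℕ) (hN : N ≠ 0)
    (hcard : ∀ x, Nat.card {y // f y = x} = N) : mass G Y = N * mass G X := by
  let F : orbitRel.Quotient G Y → orbitRel.Quotient G X :=
    fun c => Quotient.mk (orbitRel G X) (f c.out)
  unfold mass
  -- Group the orbits of Y by the orbit of X below them. Over the orbit of x each term is (points of
  -- that orbit over x) / |stabilizer of x|, and the numerators add up to N.
  rw [← (Equiv.sigmaFiberEquiv F).tsum_eq, ENNReal.tsum_sigma', ← ENNReal.tsum_mul_left]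
  refine tsum_congr fun c => ?_
  set x := c.out with hx
  have hc : Quotient.mk (orbitRel G X) x = c := Quotient.out_eq c
  have := hfin x
  have hS0 : Nat.card (stabilizer G x) ≠ 0 := Nat.card_pos.ne'
  have hterm : ∀ d : {d // F d = c}, ((Nat.card (stabilizer G d.1.out) : ℝ≥0∞))⁻¹ =
      (Nat.card {y // f y = x ∧ Quotient.mk (orbitRel G Y) y = d.1} : ℝ≥0∞) *
        ((Nat.card (stabilizer G x) : ℝ≥0∞))⁻¹ := by
    intro d
    have h := card_fiber_inter_orbit f hf x d.1 (d.2.trans hc.symm)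
    have hd0 : Nat.card (stabilizer G d.1.out) ≠ 0 := fun h0 => hS0 (by rw [← h, h0, mul_zero])
    have hf0 : Nat.card {y // f y = x ∧ Quotient.mk (orbitRel G Y) y = d.1} ≠ 0 :=
      fun h0 => hS0 (by rw [← h, h0, zero_mul])
    rw [← h]
    push_cast
    rw [ENNReal.mul_inv (by simp) (by simp), ← mul_assoc, ENNReal.mul_inv_cancel, one_mul]
    · exact_mod_cast hf0
    · exact ENNReal.natCast_ne_top _
  simp only [Equiv.sigmaFiberEquiv_apply]
  rw [tsum_congr hterm, ENNReal.tsum_mul_right]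
  congr 1
  have hfib : Finite {y // f y = x} := Nat.finite_of_card_ne_zero (by rw [hcard]; exact hN)
  let p : {y // f y = x} → {d // F d = c} := fun y => ⟨Quotient.mk (orbitRel G Y) y.1, by
    obtain ⟨g, hg⟩ := Quotient.mk_out (s := orbitRel G Y) y.1
    rw [← hc]
    exact Quotient.sound ⟨g, (congrArg (g • ·) y.2.symm).trans
      ((hf g y.1).symm.trans (congrArg f hg))⟩⟩
  rw [← hcard x]
  have hcoe : ∀ (T : Type _) [Finite T], (Nat.card T : ℝ≥0∞) = ∑' _ : T, (1 : ℝ≥0∞) := by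
    intro T _
    have := Fintype.ofFinite T
    simp
  rw [hcoe {y // f y = x}, ← (Equiv.sigmaFiberEquiv p).tsum_eq, ENNReal.tsum_sigma']
  refine tsum_congr fun d => ?_
  rw [← hcoe]
  congr 1
  refine Nat.card_congr
    { toFun := fun y => ⟨⟨y.1, y.2.1⟩, Subtype.ext y.2.2⟩
      invFun := fun y => ⟨y.1.1, y.1.2, congrArg Subtype.val y.2⟩
      left_inv := fun _ => rfl
      right_inv := fun _ => rfl }

/-- Two actions related by a map which is a bijection on orbits and on stabilizers have the same
mass. -/
theorem mass_eq_of_fullyFaithful {H Z : Type*} [Group H] [MulAction H Z] (ι : H →* G)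
    (hι : Function.Injective ι) (φ : Z → X) (hφ : ∀ h z, φ (h • z) = ι h • φ z)
    (hinj : Function.Injective φ)
    (hfull : ∀ g z z', g • φ z = φ z' → ∃ h, ι h = g) (hsurj : ∀ x, ∃ (g : G) (z : Z), g • φ z = x) :
    mass H Z = mass G X := by
  let F : orbitRel.Quotient H Z → orbitRel.Quotient G X :=
    Quotient.map' φ fun a b ⟨h, hh⟩ => ⟨ι h, by
      change ι h • φ b = φ a
      rw [← hφ]; exact congrArg φ hh⟩
  have hF : Function.Bijective F := by
    constructor
    · intro c d
      induction c using Quotient.inductionOn with | h a => ?_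
      induction d using Quotient.inductionOn with | h b => ?_
      intro h
      obtain ⟨g, hg⟩ := Quotient.exact h
      obtain ⟨k, rfl⟩ := hfull g _ _ hg
      refine Quotient.sound ⟨k, hinj ?_⟩
      change φ (k • b) = φ a
      rw [hφ]; exact hg
    · intro c
      induction c using Quotient.inductionOn with | h x => ?_
      obtain ⟨g, z, rfl⟩ := hsurj x
      exact ⟨Quotient.mk _ z, Quotient.sound ⟨g⁻¹, by simp⟩⟩
  unfold mass
  rw [← (Equiv.ofBijective F hF).tsum_eq]
  refine tsum_congr fun c => ?_
  induction c using Quotient.inductionOn with | h z => ?_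
  rw [card_stabilizer_out]
  change _ = ((Nat.card (stabilizer G (Quotient.mk (orbitRel G X) (φ z)).out) : ℝ≥0∞))⁻¹
  rw [card_stabilizer_out]
  congr 2
  refine Nat.card_congr (Equiv.ofBijective
    (fun h : stabilizer H z => (⟨ι h, by
      rw [mem_stabilizer_iff, ← hφ, show (h : H) • z = z from h.2]⟩ : stabilizer G (φ z))) ⟨?_, ?_⟩)
  · intro a b hab
    exact Subtype.ext (hι (congrArg Subtype.val hab))
  · rintro ⟨g, hg⟩
    obtain ⟨h, rfl⟩ := hfull g z z hg
    refine ⟨⟨h, hinj ?_⟩, rfl⟩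
    rw [hφ]; exact hg

end MulAction

/-! ### Poisson summation on ℤᵈ -/

section Poisson

open MeasureTheory UnitAddTorus

variable {d : Type*} [Fintype d]

/-- The isomorphism of `ℤᵈ` with the standard lattice of `ℝᵈ`. -/
noncomputable def intPiEquivSpan (d : Type*) [Fintype d] :
    (d → ℤ) ≃ Submodule.span ℤ (Set.range (Pi.basisFun ℝ d)) :=
  ((Pi.basisFun ℝ d).restrictScalars ℤ).equivFun.symm.toEquiv

theorem coe_intPiEquivSpan (m : d → ℤ) :
    (intPiEquivSpan d m : d → ℝ) = fun i => (m i : ℝ) := by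
  classical
  ext i
  simp [intPiEquivSpan, Module.Basis.equivFun_symm_apply, Finset.sum_apply, Pi.single_apply]

theorem mFourier_coe (k : d → ℤ) (x : d → ℝ) :
    mFourier k (fun i => (x i : UnitAddCircle)) =
      Complex.exp (2 * Real.pi * Complex.I * ∑ i, (k i : ℂ) * x i) := by
  simp only [mFourier, ContinuousMap.coe_mk, fourier_coe_apply, ← Complex.exp_sum]
  congr 1
  rw [Finset.mul_sum]
  refine Finset.sum_congr rfl fun i _ => ?_
  push_cast
  ring

theorem mFourier_coe_add_int (k m : d → ℤ) (x : d → ℝ) :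
    mFourier k (fun i => ((x i + m i : ℝ) : UnitAddCircle)) =
      mFourier k (fun i => (x i : UnitAddCircle)) := by
  congr 1
  ext i
  have h : ((m i : ℝ) : UnitAddCircle) = 0 := by
    rw [AddCircle.coe_eq_zero_iff]
    exact ⟨m i, by simp⟩
  rw [AddCircle.coe_add, h, add_zero]

/-- **Poisson summation** on `ℤᵈ ⊂ ℝᵈ`. -/
theorem tsum_add_int_eq_tsum_integral_mul_exp (f : (d → ℝ) → ℂ) (hc : Continuous f)
    (h_integral : Integrable f)
    (hsum : ∀ R : ℝ, ∃ u : (d → ℤ) → ℝ, Summable u ∧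
      ∀ (m : d → ℤ) (x : d → ℝ), ‖x‖ ≤ R → ‖f fun i => x i + m i‖ ≤ u m)
    (hF : Summable fun k : d → ℤ =>
      ∫ x : d → ℝ, Complex.exp (2 * Real.pi * Complex.I * ∑ i, ((-k) i : ℂ) * x i) * f x)
    (x : d → ℝ) :
    ∑' m : d → ℤ, f (fun i => x i + m i) = ∑' k : d → ℤ,
      (∫ y : d → ℝ, Complex.exp (2 * Real.pi * Complex.I * ∑ i, ((-k) i : ℂ) * y i) * f y) *
        Complex.exp (2 * Real.pi * Complex.I * ∑ i, (k i : ℂ) * x i) := by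
  have hfm : ∀ m : d → ℤ, Continuous fun x : d → ℝ => f fun i => x i + m i := fun m => by fun_prop
  have hG : Continuous fun x : d → ℝ => ∑' m : d → ℤ, f fun i => x i + m i := by
    rw [continuous_iff_continuousAt]
    intro x₀
    obtain ⟨u, hu, hle⟩ := hsum (‖x₀‖ + 1)
    have : ContinuousOn (fun x : d → ℝ => ∑' m : d → ℤ, f fun i => x i + m i)
        (Metric.ball x₀ 1) := by
      refine continuousOn_tsum (fun m => (hfm m).continuousOn) hu fun m x hx => hle m x ?_
      have h1 : ‖x - x₀‖ < 1 := by simpa [dist_eq_norm] using hx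
      have h2 := norm_add_le (x - x₀) x₀
      rw [sub_add_cancel] at h2
      linarith
    exact this.continuousAt (Metric.ball_mem_nhds _ one_pos)
  let G : C(d → ℝ, ℂ) := ⟨_, hG⟩
  let p : C(d → ℝ, UnitAddTorus d) :=
    ⟨Pi.map fun _ => (fun t : ℝ => (t : UnitAddCircle)), by
      exact (IsOpenQuotientMap.piMap fun _ => QuotientAddGroup.isOpenQuotientMap_mk).continuous⟩
  have hp : Topology.IsQuotientMap p :=
    (IsOpenQuotientMap.piMap fun _ : d =>
      QuotientAddGroup.isOpenQuotientMap_mk (N := AddSubgroup.zmultiples (1 : ℝ))).isQuotientMap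
  -- The periodization is invariant under ℤᵈ, so it descends to a continuous function on the torus.
  have hfac : Function.FactorsThrough G p := by
    intro a b hab
    have h1 : ∀ i, ∃ n : ℤ, b i = a i + n := fun i => by
      have h2 : ((a i : ℝ) : UnitAddCircle) = (b i : ℝ) := congrFun hab i
      rw [eq_comm, ← sub_eq_zero, ← AddCircle.coe_sub, AddCircle.coe_eq_zero_iff] at h2
      obtain ⟨n, hn⟩ := h2
      refine ⟨n, ?_⟩
      simp only [zsmul_eq_mul, mul_one] at hn
      linarith
    choose n hn using h1
    change ∑' m : d → ℤ, f (fun i => a i + m i) = ∑' m : d → ℤ, f fun i => b i + m i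
    rw [← (Equiv.addLeft n).tsum_eq]
    refine tsum_congr fun m => congrArg f (funext fun i => ?_)
    simp [hn, add_assoc]
  let F : C(UnitAddTorus d, ℂ) := hp.lift G hfac
  have hFp : ∀ y : d → ℝ, F (fun i => (y i : UnitAddCircle)) =
      ∑' m : d → ℤ, f fun i => y i + m i := fun y =>
    DFunLike.congr_fun (hp.lift_comp G hfac) y
  -- Unfolding: characters are ℤᵈ-periodic, so integrating the periodization over a unit cell is
  -- integrating f over ℝᵈ.
  have hcoeff : ∀ k : d → ℤ, mFourierCoeff F k =
      ∫ y : d → ℝ, Complex.exp (2 * Real.pi * Complex.I * ∑ i, ((-k) i : ℂ) * y i) * f y := by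
    intro k
    rw [mFourierCoeff_eq_integral F k 0]
    have hset : ({x : d → ℝ | ∀ i, x i ∈ Set.Ioc ((0 : d → ℝ) i) ((0 : d → ℝ) i + 1)} : Set _)
        =ᵐ[volume] ZSpan.fundamentalDomain (Pi.basisFun ℝ d) := by
      rw [ZSpan.fundamentalDomain_pi_basisFun]
      have h1 : ({x : d → ℝ | ∀ i, x i ∈ Set.Ioc ((0 : d → ℝ) i) ((0 : d → ℝ) i + 1)} : Set _)
          = Set.univ.pi fun _ : d => Set.Ioc (0 : ℝ) 1 := by
        ext x; simp
      rw [h1]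
      exact (Measure.univ_pi_Ioc_ae_eq_Icc (f := fun _ : d => (0 : ℝ)) (g := fun _ => 1)).trans
        (Measure.univ_pi_Ico_ae_eq_Icc (f := fun _ : d => (0 : ℝ)) (g := fun _ => 1)).symm
    rw [setIntegral_congr_set hset]
    set D := ZSpan.fundamentalDomain (Pi.basisFun ℝ d) with hD
    have hDm : MeasurableSet D := ZSpan.fundamentalDomain_measurableSet _
    have hDb : ∃ R, ∀ x ∈ D, ‖x‖ ≤ R :=
      isBounded_iff_forall_norm_le.1 (ZSpan.fundamentalDomain_isBounded _)
    obtain ⟨R, hR⟩ := hDb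
    have hDfin : volume D ≠ ⊤ :=
      (ZSpan.fundamentalDomain_isBounded (Pi.basisFun ℝ d)).measure_lt_top.ne
    have : IsFiniteMeasure (volume.restrict D) := ⟨by simpa using hDfin.lt_top⟩
    obtain ⟨u, hu, hle⟩ := hsum R
    let e : (d → ℝ) → ℂ := fun y => mFourier (-k) (fun i => (y i : UnitAddCircle))
    have hec : Continuous e := by
      have : e = fun y => Complex.exp (2 * Real.pi * Complex.I * ∑ i, ((-k) i : ℂ) * y i) :=
        funext fun y => by simp only [e, mFourier_coe]
      rw [this]; fun_prop
    have hen : ∀ y, ‖e y‖ = 1 := fun y => by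
      simp only [e, mFourier, ContinuousMap.coe_mk, norm_prod, fourier_apply, Circle.norm_coe,
        Finset.prod_const_one]
    have hswap := hasSum_integral_of_summable_integral_norm (μ := volume.restrict D)
      (F := fun (m : d → ℤ) y => e y * f fun i => y i + m i) (fun m => by
        refine Integrable.mono' (integrable_const (u m))
          (hec.mul (hfm m)).aestronglyMeasurable ?_
        refine (ae_restrict_iff' hDm).2 (Filter.Eventually.of_forall fun y hy => ?_)
        rw [norm_mul, hen, one_mul]
        exact hle m y (hR y hy)) (by
        refine Summable.of_nonneg_of_le (fun m => integral_nonneg fun _ => norm_nonneg _)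
          (fun m => ?_) (hu.mul_left (volume.real D))
        calc ∫ y in D, ‖e y * f fun i => y i + m i‖ ≤ ∫ _ in D, u m := by
              refine integral_mono_of_nonneg (Filter.Eventually.of_forall fun _ => norm_nonneg _)
                (integrable_const _) ?_
              refine (ae_restrict_iff' hDm).2 (Filter.Eventually.of_forall fun y hy => ?_)
              change ‖e y * f fun i => y i + m i‖ ≤ u m
              rw [norm_mul, hen, one_mul]
              exact hle m y (hR y hy)
          _ = volume.real D * u m := by simp [mul_comm])
    have hei : Integrable (fun y => e y * f y) :=
      h_integral.bdd_mul hec.aestronglyMeasurable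
        (Filter.Eventually.of_forall fun y => (hen y).le)
    have : VAddInvariantMeasure (Submodule.span ℤ (Set.range (Pi.basisFun ℝ d))) (d → ℝ) volume :=
      inferInstanceAs (VAddInvariantMeasure
        (Submodule.span ℤ (Set.range (Pi.basisFun ℝ d))).toAddSubgroup (d → ℝ) volume)
    have hunf := (ZSpan.isAddFundamentalDomain (Pi.basisFun ℝ d) volume).integral_eq_tsum''
      (fun y => e y * f y) hei
    rw [← (intPiEquivSpan d).tsum_eq] at hunf
    calc ∫ y in D, mFourier (-k) (fun i => (y i : UnitAddCircle)) • F (fun i => (y i : UnitAddCircle))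
        = ∫ y in D, ∑' m : d → ℤ, e y * f fun i => y i + m i := by
          refine setIntegral_congr_fun hDm fun y _ => ?_
          simp only [hFp, smul_eq_mul, tsum_mul_left, e]
      _ = ∑' m : d → ℤ, ∫ y in D, e y * f fun i => y i + m i := hswap.tsum_eq.symm
      _ = ∫ y, e y * f y := by
          rw [hunf]
          refine tsum_congr fun m => setIntegral_congr_fun hDm fun y _ => ?_
          have h1 : (intPiEquivSpan d m +ᵥ y : d → ℝ) = fun i => y i + m i := by
            ext i
            rw [Submodule.vadd_def, vadd_eq_add, Pi.add_apply, coe_intPiEquivSpan, add_comm]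
          simp only [h1, e, mFourier_coe_add_int]
      _ = _ := by
          refine integral_congr_ae (Filter.Eventually.of_forall fun y => ?_)
          simp only [e, mFourier_coe]
  have hs : Summable (mFourierCoeff F) := by
    rw [funext hcoeff]; exact hF
  have := (hasSum_mFourier_series_apply_of_summable hs fun i => (x i : UnitAddCircle)).tsum_eq
  rw [hFp] at this
  rw [← this]
  refine tsum_congr fun k => ?_
  rw [hcoeff, mFourier_coe, smul_eq_mul]

end Poisson

/-! ### Inversion formula for theta series -/

namespace UnimodularLattice

open MeasureTheory

variable {V : Type*} [NormedAddCommGroup V] [InnerProductSpace ℝ V] [FiniteDimensional ℝ V]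

/-- Nonzero vectors have length at least 1, so the terms are dominated by a multiple of the
convergent series of ‖x‖⁻ᴺ with N above the rank. -/
theorem IsSelfDual.summable_exp_neg_mul_norm_sq {L : Submodule ℤ V} (hL : IsSelfDual L) {c : ℝ}
    (hc : 0 < c) : Summable fun x : L => Real.exp (-c * ‖(x : V)‖ ^ 2) := by
  have := hL.discreteTopology
  set N := Module.finrank ℤ L + 1 with hN
  have h1 := (ZLattice.summable_norm_pow_inv L N (by omega)).mul_left ((N.factorial : ℝ) / c ^ N)
  refine Summable.of_norm_bounded_eventually h1 ?_
  rw [Filter.eventually_cofinite]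
  refine (Set.finite_singleton (0 : L)).subset fun x hx => ?_
  by_contra h0
  refine hx ?_
  have hx1 : 1 ≤ ‖(x : V)‖ := hL.one_le_norm x.2 (by simpa using h0)
  have hr : (0 : ℝ) < ‖(x : V)‖ := by linarith
  rw [Real.norm_eq_abs, abs_of_pos (Real.exp_pos _), neg_mul, Real.exp_neg, Submodule.coe_norm,
    inv_pow, ← div_eq_mul_inv, div_div, ← mul_pow, inv_le_comm₀ (Real.exp_pos _) (by positivity),
    inv_div]
  calc (c * ‖(x : V)‖) ^ N / N.factorial ≤ (c * ‖(x : V)‖ ^ 2) ^ N / N.factorial := by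
        gcongr
        nlinarith
    _ ≤ _ := Real.pow_div_factorial_le_exp _ (by positivity) _

theorem norm_exp_pi_mul_I_mul (σ : ℂ) (r s : ℝ) :
    ‖Complex.exp (Real.pi * Complex.I * σ * (r : ℂ) ^ 2 + 2 * Real.pi * Complex.I * (s : ℂ))‖ =
      Real.exp (-(Real.pi * σ.im) * r ^ 2) := by
  rw [Complex.norm_exp]
  congr 1
  simp [← Complex.ofReal_pow]

/-- The terms of the theta series of a lattice with a character are summable. -/
theorem IsSelfDual.summable_theta {L : Submodule ℤ V} (hL : IsSelfDual L) {σ : ℂ} (hσ : 0 < σ.im)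
    (a : V) : Summable fun y : L => Complex.exp (Real.pi * Complex.I * σ * (‖(y : V)‖ : ℂ) ^ 2 +
      2 * Real.pi * Complex.I * (inner ℝ (y : V) a : ℝ)) := by
  refine Summable.of_norm ?_
  simp_rw [norm_exp_pi_mul_I_mul]
  exact hL.summable_exp_neg_mul_norm_sq (by positivity)

theorem exists_integral_comp_equiv_eq_mul [MeasurableSpace V] [BorelSpace V] {n : ℕ}
    (T : (Fin n → ℝ) ≃L[ℝ] V) : ∃ C : ℝ, ∀ h : V → ℂ,
      (Integrable h → Integrable fun t => h (T t)) ∧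
      ∫ t, h (T t) = C * ∫ v, h v := by
  have := T.isAddHaarMeasure_map (volume : Measure (Fin n → ℝ))
  have hμ := Measure.isAddLeftInvariant_eq_smul (Measure.map T (volume : Measure (Fin n → ℝ)))
    (volume : Measure V)
  generalize Measure.addHaarScalarFactor (Measure.map T (volume : Measure (Fin n → ℝ)))
    (volume : Measure V) = C at hμ
  refine ⟨C, fun h => ⟨fun hh => ?_, ?_⟩⟩
  · have h1 : Integrable h (Measure.map T (volume : Measure (Fin n → ℝ))) := by
      rw [hμ]
      exact hh.smul_measure_nnreal
    exact (integrable_map_equiv T.toHomeomorph.toMeasurableEquiv h).1 h1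
  · have h1 : ∫ t, h (T t) = ∫ v, h v ∂(Measure.map T (volume : Measure (Fin n → ℝ))) :=
      (integral_map_equiv T.toHomeomorph.toMeasurableEquiv h).symm
    rw [h1, hμ, integral_smul_nnreal_measure]
    simp [NNReal.smul_def]

/-- Poisson summation for a Gaussian in the coordinates of an integral basis; the frequencies run
over the dual lattice, which is L. The Jacobian C is left undetermined. -/
theorem IsSelfDual.exists_theta_poisson {L : Submodule ℤ V} (hL : IsSelfDual L) :
    ∃ C : ℝ, ∀ τ : ℂ, 0 < τ.im → ∀ a : V,
      ∑' x : L, Complex.exp (Real.pi * Complex.I * τ * (‖a + x‖ : ℂ) ^ 2) =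
        C * (Complex.I / τ) ^ (Module.finrank ℝ V / 2 : ℂ) *
          ∑' y : L, Complex.exp (Real.pi * Complex.I * (-1 / τ) * (‖(y : V)‖ : ℂ) ^ 2 +
            2 * Real.pi * Complex.I * (inner ℝ (y : V) a : ℝ)) := by
  let _ : MeasurableSpace V := borel V
  have : BorelSpace V := ⟨rfl⟩
  set n := Module.finrank ℝ V with hn
  obtain ⟨b, hb⟩ := hL.exists_basis hn.symm
  have hbL : ∀ i, b i ∈ L := fun i => by rw [hb]; exact Submodule.subset_span ⟨i, rfl⟩
  let T : (Fin n → ℝ) ≃L[ℝ] V := b.equivFunL.symm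
  have hT : ∀ t, T t = ∑ i, t i • b i := fun t => b.equivFun_symm_apply t
  obtain ⟨C, hC⟩ := exists_integral_comp_equiv_eq_mul T
  refine ⟨C, fun τ hτ a => ?_⟩
  -- the two parametrizations of the lattice by integer vectors
  have hTL : ∀ m : Fin n → ℤ, T (fun i => (m i : ℝ)) ∈ L := fun m => by
    rw [hT]
    refine L.sum_mem fun i _ => ?_
    rw [Int.cast_smul_eq_zsmul]
    exact L.smul_mem _ (hbL i)
  let eL : (Fin n → ℤ) ≃ L := Equiv.ofBijective (fun m => ⟨T fun i => (m i : ℝ), hTL m⟩) <| by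
    constructor
    · intro m m' h
      have := T.injective (congrArg Subtype.val h)
      ext i
      exact_mod_cast congrFun this i
    · rintro ⟨x, hx⟩
      have hx' := hx
      rw [hb, b.mem_span_iff_repr_mem ℤ] at hx'
      choose m hm using hx'
      refine ⟨m, Subtype.ext ?_⟩
      change T (fun i => (m i : ℝ)) = x
      rw [hT, ← b.sum_repr x]
      exact Finset.sum_congr rfl fun i _ => by rw [← hm i]; simp
  choose yk hyk using fun k : Fin n → ℤ => exists_inner_basis_eq b fun i => (k i : ℝ)
  have hyL : ∀ k, yk k ∈ L := fun k => (hL _).2 fun z hz => by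
    rw [hb] at hz
    exact exists_inner_span_eq b _ (fun i => ⟨k i, hyk k i⟩) hz
  let eD : (Fin n → ℤ) ≃ L := Equiv.ofBijective (fun k => ⟨yk k, hyL k⟩) <| by
    constructor
    · intro k k' h
      ext i
      have h1 : yk k = yk k' := congrArg Subtype.val h
      have h2 : (k i : ℝ) = k' i := by rw [← hyk, ← hyk, h1]
      exact_mod_cast h2
    · rintro ⟨x, hx⟩
      choose k hk using fun i => hL.exists_inner_eq hx (hbL i)
      refine ⟨k, Subtype.ext (InnerProductSpace.ext_inner_right_basis b fun i => ?_)⟩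
      exact (hyk k i).trans (hk i).symm
  have hyT : ∀ k t, inner ℝ (yk k) (T t) = ∑ i, (k i : ℝ) * t i := fun k t => by
    rw [hT, inner_sum]
    exact Finset.sum_congr rfl fun i _ => by rw [inner_smul_right, hyk, mul_comm]
  let g : V → ℂ := fun v => Complex.exp (Real.pi * Complex.I * τ * (‖v‖ : ℂ) ^ 2)
  have hgnorm : ∀ v, ‖g v‖ = Real.exp (-(Real.pi * τ.im) * ‖v‖ ^ 2) := fun v => by
    have := norm_exp_pi_mul_I_mul τ ‖v‖ 0
    simpa [g] using this
  have hre : 0 < (-(Real.pi * Complex.I * τ) : ℂ).re := by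
    simpa using mul_pos Real.pi_pos hτ
  have hτ0 : τ ≠ 0 := fun h => by simp [h] at hτ
  have hpi : (Real.pi : ℂ) ≠ 0 := by exact_mod_cast Real.pi_ne_zero
  have hgint : Integrable g := by
    have := GaussianFourier.integrable_cexp_neg_mul_sq_norm_add hre 0 (0 : V)
    simpa [g] using this
  have hcoeff : ∀ k : Fin n → ℤ, ∫ t : Fin n → ℝ,
      Complex.exp (2 * Real.pi * Complex.I * ∑ i, ((-k) i : ℂ) * t i) * g (T t) =
      C * (Complex.I / τ) ^ (n / 2 : ℂ) *
        Complex.exp (Real.pi * Complex.I * (-1 / τ) * (‖yk k‖ : ℂ) ^ 2) := fun k => by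
    have h1 := (hC fun v => Complex.exp (2 * Real.pi * Complex.I * (-(inner ℝ (yk k) v : ℝ))) *
      g v).2
    have h2 : ∀ t : Fin n → ℝ, Complex.exp (2 * Real.pi * Complex.I * ∑ i, ((-k) i : ℂ) * t i) =
        Complex.exp (2 * Real.pi * Complex.I * (-(inner ℝ (yk k) (T t) : ℝ))) := fun t => by
      rw [hyT]; push_cast; simp
    simp_rw [h2]
    rw [h1, mul_assoc (C : ℂ)]
    refine congrArg ((C : ℂ) * ·) ?_
    have h3 := fourier_gaussian_innerProductSpace (V := V) hre (yk k)
    rw [Real.fourier_eq'] at h3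
    have h4 : ((Real.pi : ℂ) / -(Real.pi * Complex.I * τ)) = Complex.I / τ := by
      field_simp; simp
    have h5 : -(Real.pi : ℂ) ^ 2 * (‖yk k‖ : ℂ) ^ 2 / -(Real.pi * Complex.I * τ) =
        Real.pi * Complex.I * (-1 / τ) * (‖yk k‖ : ℂ) ^ 2 := by
      field_simp; simp
    rw [h4, h5] at h3
    refine Eq.trans ?_ h3
    refine integral_congr_ae (Filter.Eventually.of_forall fun v => ?_)
    simp only [smul_eq_mul, g, neg_neg]
    congr 2
    rw [real_inner_comm]
    push_cast
    ring
  have him : 0 < (-1 / τ).im := by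
    rw [Complex.div_im]
    have := Complex.normSq_pos.2 hτ0
    simp only [Complex.neg_im, Complex.one_im, Complex.neg_re, Complex.one_re]
    have h : 0 < τ.im / Complex.normSq τ := by positivity
    ring_nf at h ⊢
    exact h
  have key := tsum_add_int_eq_tsum_integral_mul_exp (fun t : Fin n → ℝ => g (T t))
    (by fun_prop) ((hC g).1 hgint) ?_ ?_ (T.symm a)
  · simp_rw [hcoeff] at key
    rw [← eL.tsum_eq, ← eD.tsum_eq, ← tsum_mul_left]
    convert! key using 1
    · refine tsum_congr fun m => ?_
      have : (T fun i => T.symm a i + (m i : ℝ)) = a + (eL m : V) := by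
        rw [show (fun i => T.symm a i + (m i : ℝ)) = T.symm a + fun i => (m i : ℝ) from rfl,
          map_add, T.apply_symm_apply]
        rfl
      simp only [g, this]
    · refine tsum_congr fun k => ?_
      rw [Complex.exp_add, ← mul_assoc]
      congr 2
      change _ * ((inner ℝ (yk k) a : ℝ) : ℂ) = _
      conv_lhs => rw [← T.apply_symm_apply a, hyT]
      push_cast
      rfl
  · intro R
    have hs := hL.summable_exp_neg_mul_norm_sq (c := Real.pi * τ.im / 2) (by positivity)
    -- Since ‖y‖² ≤ 2‖x + y‖² + 2‖x‖², half of the Gaussian decay in y survives, uniformly for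
    -- bounded x.
    refine ⟨fun m => Real.exp (Real.pi * τ.im * (‖(T : (Fin n → ℝ) →L[ℝ] V)‖ * R) ^ 2) *
      Real.exp (-(Real.pi * τ.im / 2) * ‖(eL m : V)‖ ^ 2),
      ((eL.summable_iff (f := fun x : L => _)).2 hs).mul_left _, fun m x hx => ?_⟩
    beta_reduce
    rw [hgnorm, ← Real.exp_add]
    refine Real.exp_le_exp.2 ?_
    have h1 : (T fun i => x i + (m i : ℝ)) = T x + (eL m : V) := by
      rw [show (fun i => x i + (m i : ℝ)) = x + fun i => (m i : ℝ) from rfl, map_add]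
      rfl
    rw [h1]
    have h2 : ‖T x‖ ≤ ‖(T : (Fin n → ℝ) →L[ℝ] V)‖ * R :=
      ((T : (Fin n → ℝ) →L[ℝ] V).le_opNorm x).trans (by gcongr)
    have h3 : ‖(eL m : V)‖ ≤ ‖T x + (eL m : V)‖ + ‖T x‖ := by
      have := norm_sub_le (T x + (eL m : V)) (T x)
      simpa using this
    have h4 : ‖(eL m : V)‖ ^ 2 ≤ 2 * ‖T x + (eL m : V)‖ ^ 2 + 2 * ‖T x‖ ^ 2 := by
      nlinarith [norm_nonneg (eL m : V), sq_nonneg (‖T x + (eL m : V)‖ - ‖T x‖)]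
    have h5 : ‖T x‖ ^ 2 ≤ (‖(T : (Fin n → ℝ) →L[ℝ] V)‖ * R) ^ 2 := by gcongr
    have h6 : 0 < Real.pi * τ.im := by positivity
    nlinarith
  · simp_rw [hcoeff]
    refine Summable.mul_left _ ?_
    have := hL.summable_theta him 0
    simp only [inner_zero_right, Complex.ofReal_zero, mul_zero, add_zero] at this
    exact (eD.summable_iff (f := fun y : L =>
      Complex.exp (Real.pi * Complex.I * (-1 / τ) * (‖(y : V)‖ : ℂ) ^ 2))).2 this

/-- The inversion formula for the theta series of a coset of a self-dual lattice. -/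
theorem IsSelfDual.theta_inversion {L : Submodule ℤ V} (hL : IsSelfDual L) {τ : ℂ} (hτ : 0 < τ.im)
    (a : V) :
    ∑' x : L, Complex.exp (Real.pi * Complex.I * τ * (‖a + x‖ : ℂ) ^ 2) =
      (Complex.I / τ) ^ (Module.finrank ℝ V / 2 : ℂ) *
        ∑' y : L, Complex.exp (Real.pi * Complex.I * (-1 / τ) * (‖(y : V)‖ : ℂ) ^ 2 +
          2 * Real.pi * Complex.I * (inner ℝ (y : V) a : ℝ)) := by
  obtain ⟨C, hC⟩ := hL.exists_theta_poisson
  -- At τ = i and a = 0 both sides carry the same series of positive terms, which forces C = 1.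
  have h := hC Complex.I (by simp) 0
  have hS : (∑' x : L, Complex.exp (Real.pi * Complex.I * Complex.I * (‖(x : V)‖ : ℂ) ^ 2)) ≠ 0 := by
    have h1 : ∀ x : L, Complex.exp (Real.pi * Complex.I * Complex.I * (‖(x : V)‖ : ℂ) ^ 2) =
        ((Real.exp (-Real.pi * ‖(x : V)‖ ^ 2) : ℝ) : ℂ) := fun x => by
      push_cast
      congr 1
      rw [mul_assoc (Real.pi : ℂ), Complex.I_mul_I]
      ring
    simp_rw [h1]
    rw [← Complex.ofReal_tsum]
    have h2 := (hL.summable_exp_neg_mul_norm_sq Real.pi_pos).tsum_pos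
      (fun _ => (Real.exp_pos _).le) 0 (Real.exp_pos _)
    exact_mod_cast h2.ne'
  have hI : (-1 / Complex.I : ℂ) = Complex.I := by
    rw [div_eq_iff Complex.I_ne_zero, Complex.I_mul_I]
  simp only [zero_add, inner_zero_right, Complex.ofReal_zero, mul_zero, add_zero, hI,
    div_self Complex.I_ne_zero, Complex.one_cpow, mul_one] at h
  have hC1 : (C : ℂ) = 1 := mul_right_cancel₀ hS (by rw [← h, one_mul])
  rw [hC τ hτ a, hC1, one_mul]

end UnimodularLattice

/-! ### Theta series in dimension 32 as modular forms of weight 16 -/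

namespace UnimodularLattice

open UpperHalfPlane ModularForm SlashInvariantForm MatrixGroups

variable {V : Type*} [NormedAddCommGroup V] [InnerProductSpace ℝ V]

/-- All vectors of `L` have even norm `(x, x)`. -/
def HasEvenNorms (L : Submodule ℤ V) : Prop :=
  ∀ x ∈ L, ∃ k : ℤ, inner ℝ x x = 2 * (k : ℝ)

/-- The theta series of a lattice. -/
noncomputable def theta (L : Submodule ℤ V) (τ : ℂ) : ℂ :=
  ∑' x : L, Complex.exp (Real.pi * Complex.I * τ * (‖(x : V)‖ : ℂ) ^ 2)

theorem HasEvenNorms.exists_nat {L : Submodule ℤ V} (he : HasEvenNorms L) (x : L) :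
    ∃ m : ℕ, ‖(x : V)‖ ^ 2 = 2 * m := by
  obtain ⟨k, hk⟩ := he x x.2
  rw [real_inner_self_eq_norm_sq] at hk
  have h0 : 0 ≤ k := by
    have : (0 : ℝ) ≤ k := by nlinarith [sq_nonneg ‖(x : V)‖]
    exact_mod_cast this
  lift k to ℕ using h0
  exact ⟨k, by simpa using hk⟩

theorem HasEvenNorms.theta_add_one {L : Submodule ℤ V} (he : HasEvenNorms L) (τ : ℂ) :
    theta L (τ + 1) = theta L τ := by
  refine tsum_congr fun x => ?_
  obtain ⟨m, hm⟩ := he.exists_nat x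
  rw [← Complex.ofReal_pow, hm]
  refine Complex.exp_eq_exp_iff_exists_int.2 ⟨m, ?_⟩
  push_cast
  ring

theorem HasEvenNorms.theta_slash_T {L : Submodule ℤ V} (he : HasEvenNorms L) :
    (fun τ : ℍ => theta L τ) ∣[(16 : ℤ)] ModularGroup.T = fun τ : ℍ => theta L τ := by
  ext z
  have hd : denom ModularGroup.T z = 1 := by
    rw [ModularGroup.denom_apply]
    simp [ModularGroup.T]
  rw [SL_slash_apply, hd, modular_T_smul]
  simp [add_comm, he.theta_add_one]

theorem I_div_cpow_sixteen {τ : ℂ} (n : ℕ) (hn : n = 32) :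
    (Complex.I / τ) ^ ((n : ℂ) / 2) = (τ ^ 16)⁻¹ := by
  rw [hn, show ((32 : ℕ) : ℂ) / 2 = ((16 : ℕ) : ℂ) by norm_num, Complex.cpow_natCast, div_pow,
    show Complex.I ^ 16 = (Complex.I ^ 4) ^ 4 by ring, Complex.I_pow_four, one_pow, one_div]

theorem im_neg_one_div_pos {τ : ℂ} (hτ : 0 < τ.im) : 0 < (-1 / τ).im := by
  have hτ0 : τ ≠ 0 := fun h => by simp [h] at hτ
  have h : 0 < τ.im / Complex.normSq τ := div_pos hτ (Complex.normSq_pos.2 hτ0)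
  rw [Complex.div_im]
  simp only [Complex.neg_im, Complex.one_im, Complex.neg_re, Complex.one_re]
  ring_nf at h ⊢
  exact h

section FiniteDimensional

variable [FiniteDimensional ℝ V] {L : Submodule ℤ V}

theorem IsSelfDual.summable_theta_terms (hL : IsSelfDual L) {τ : ℂ} (hτ : 0 < τ.im) :
    Summable fun x : L => Complex.exp (Real.pi * Complex.I * τ * (‖(x : V)‖ : ℂ) ^ 2) := by
  simpa using hL.summable_theta hτ 0

theorem IsSelfDual.theta_neg_one_div (hL : IsSelfDual L) (hdim : Module.finrank ℝ V = 32) {τ : ℂ}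
    (hτ : 0 < τ.im) : theta L (-1 / τ) = τ ^ 16 * theta L τ := by
  have hτ0 : τ ≠ 0 := fun h => by simp [h] at hτ
  have h := hL.theta_inversion hτ 0
  rw [I_div_cpow_sixteen _ hdim] at h
  simp only [zero_add, inner_zero_right, Complex.ofReal_zero, mul_zero, add_zero] at h
  change theta L τ = _ * theta L (-1 / τ) at h
  rw [h]
  field_simp

theorem IsSelfDual.differentiableAt_theta (hL : IsSelfDual L) {τ : ℂ} (hτ : 0 < τ.im) :
    DifferentiableAt ℂ (theta L) τ := by
  have hopen : IsOpen {z : ℂ | τ.im / 2 < z.im} := isOpen_lt continuous_const Complex.continuous_im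
  have h : DifferentiableOn ℂ (theta L) {z : ℂ | τ.im / 2 < z.im} := by
    refine Complex.differentiableOn_tsum_of_summable_norm
      (hL.summable_exp_neg_mul_norm_sq (c := Real.pi * (τ.im / 2)) (by positivity))
      (fun x => by fun_prop) hopen fun x z hz => ?_
    have h1 := norm_exp_pi_mul_I_mul z ‖(x : V)‖ 0
    simp only [Complex.ofReal_zero, mul_zero, add_zero] at h1
    rw [h1]
    have hz' : τ.im / 2 < z.im := hz
    refine Real.exp_le_exp.2 (mul_le_mul_of_nonneg_right (neg_le_neg ?_) (sq_nonneg _))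
    exact mul_le_mul_of_nonneg_left hz'.le Real.pi_pos.le
  exact h.differentiableAt (hopen.mem_nhds (by change τ.im / 2 < τ.im; linarith))

/-- Collect the vectors by norm: with q = exp(2πiτ), a vector of norm 2m contributes qᵐ. -/
theorem IsSelfDual.hasSum_theta (hL : IsSelfDual L) (he : HasEvenNorms L) (τ : ℍ) :
    HasSum (fun m : ℕ => (Nat.card {x : L // ‖(x : V)‖ ^ 2 = 2 * m} : ℂ) •
      Function.Periodic.qParam 1 τ ^ m) (theta L τ) := by
  have hs := (hL.summable_theta_terms τ.im_pos).hasSum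
  choose N hN using he.exists_nat
  rw [← (Equiv.sigmaFiberEquiv N).hasSum_iff] at hs
  refine hs.sigma fun m => ?_
  have hfib : ∀ x : L, N x = m ↔ ‖(x : V)‖ ^ 2 = 2 * m := fun x => by
    rw [hN x]
    constructor
    · rintro rfl; rfl
    · intro h
      exact_mod_cast mul_left_cancel₀ two_ne_zero h
  have hfin : Finite {x : L // N x = m} := by
    have h1 := hL.finite_norm_le (Real.sqrt (2 * m))
    have h2 : (Subtype.val ⁻¹' {x | x ∈ L ∧ ‖x‖ ≤ Real.sqrt (2 * m)} : Set L).Finite :=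
      h1.preimage Subtype.val_injective.injOn
    refine (h2.subset fun x (hx : N x = m) => ⟨x.2, ?_⟩).to_subtype
    exact Real.le_sqrt_of_sq_le ((hfib x).1 hx).le
  have hterm : ∀ x : {x : L // N x = m}, Complex.exp (Real.pi * Complex.I * τ *
      (‖((x : L) : V)‖ : ℂ) ^ 2) = Function.Periodic.qParam 1 τ ^ m := fun x => by
    rw [← Complex.ofReal_pow, (hfib x).1 x.2, Function.Periodic.qParam, ← Complex.exp_nat_mul]
    congr 1
    push_cast
    ring
  have := Fintype.ofFinite {x : L // N x = m}
  have hcard : Nat.card {x : L // ‖(x : V)‖ ^ 2 = 2 * m} = Nat.card {x : L // N x = m} :=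
    Nat.card_congr (Equiv.subtypeEquivRight fun x => (hfib x).symm)
  rw [hcard]
  have h := hasSum_fintype fun x : {x : L // N x = m} => Complex.exp (Real.pi * Complex.I * τ *
      (‖((x : L) : V)‖ : ℂ) ^ 2)
  convert! h using 1
  simp [hterm]

theorem IsSelfDual.theta_slash_S (hL : IsSelfDual L) (hdim : Module.finrank ℝ V = 32) :
    (fun τ : ℍ => theta L τ) ∣[(16 : ℤ)] ModularGroup.S = fun τ : ℍ => theta L τ := by
  ext z
  rw [SL_slash_apply, UpperHalfPlane.modular_S_smul]
  have h := hL.theta_neg_one_div hdim z.im_pos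
  have hz := z.ne_zero
  have h2 : (-(z : ℂ))⁻¹ = -1 / z := by field_simp
  simp only [ModularGroup.denom_S, h2, h]
  rw [show (-16 : ℤ) = -((16 : ℕ) : ℤ) by norm_num, zpow_neg, zpow_natCast]
  field_simp

/-- The theta series of an even self-dual lattice of dimension `32`, as a modular form. -/
noncomputable def thetaForm (hL : IsSelfDual L) (he : HasEvenNorms L)
    (hdim : Module.finrank ℝ V = 32) : ModularForm 𝒮ℒ 16 where
  toFun τ := theta L τ
  slash_action_eq' A hA := by
    obtain ⟨A, rfl⟩ := hA
    exact slash_action_generators_SL2Z (hL.theta_slash_S hdim) he.theta_slash_T A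
  holo' := by
    rw [UpperHalfPlane.mdifferentiable_iff]
    refine .congr (fun z hz => (hL.differentiableAt_theta hz).differentiableWithinAt)
      fun z hz => ?_
    simp [ofComplex_apply_of_im_pos hz]
  bdd_at_cusps' hc := by
    rw [Subgroup.IsArithmetic.isCusp_iff_isCusp_SL2Z] at hc
    rw [OnePoint.isBoundedAt_iff_forall_SL2Z hc]
    -- Invariance under the whole modular group reduces every cusp to i∞, where the q-expansion
    -- gives boundedness.
    intro γ _
    rw [slash_action_generators_SL2Z (hL.theta_slash_S hdim) he.theta_slash_T]
    exact isBoundedAtImInfty_of_hasSum_qExpansion one_pos (hL.hasSum_theta he)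

theorem qExpansion_thetaForm_coeff (hL : IsSelfDual L) (he : HasEvenNorms L)
    (hdim : Module.finrank ℝ V = 32) (m : ℕ) :
    (qExpansion 1 (thetaForm hL he hdim)).coeff m =
      (Nat.card {x : L // ‖(x : V)‖ ^ 2 = 2 * m} : ℂ) :=
  (ModularFormClass.qExpansion_coeff_unique (f := thetaForm hL he hdim) one_pos
    one_mem_strictPeriods_SL (hL.hasSum_theta he) m).symm

end FiniteDimensional

open EisensteinSeries

theorem E₄_qExpansion_coeff_two : (qExpansion 1 E₄).coeff 2 = 2160 := by
  rw [E_qExpansion_coeff _ ⟨2, rfl⟩, show bernoulli 4 = -1 / 30 by decide +kernel,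
    show ArithmeticFunction.sigma (4 - 1) 2 = 9 by decide +kernel]
  norm_num

theorem E₆_qExpansion_coeff_two : (qExpansion 1 E₆).coeff 2 = -16632 := by
  rw [E_qExpansion_coeff _ ⟨3, rfl⟩, show bernoulli 6 = 1 / 42 by decide +kernel,
    show ArithmeticFunction.sigma (6 - 1) 2 = 33 by decide +kernel]
  norm_num

/-- The modular form `E₄⁴` of weight `16`. -/
noncomputable def E₄PowFour : ModularForm 𝒮ℒ 16 := ModularForm.mcast (by decide) (E₄.pow 4)

/-- The modular form `E₄ E₆²` of weight `16`. -/
noncomputable def E₄MulE₆Sq : ModularForm 𝒮ℒ 16 :=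
  ModularForm.mcast (by decide) (E₄.mul (E₆.pow 2))

theorem qExpansion_E₄PowFour : qExpansion 1 E₄PowFour = qExpansion 1 E₄ ^ 4 :=
  ModularForm.qExpansion_pow one_pos one_mem_strictPeriods_SL _ _

theorem qExpansion_E₄MulE₆Sq : qExpansion 1 E₄MulE₆Sq = qExpansion 1 E₄ * qExpansion 1 E₆ ^ 2 := by
  rw [← ModularForm.qExpansion_pow one_pos one_mem_strictPeriods_SL]
  exact ModularForm.qExpansion_mul one_pos one_mem_strictPeriods_SL _ _

/-- A modular form of weight `16` with `q`-expansion `1 + 0 q + ⋯` has `q²`-coefficient `146880`. -/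
theorem qExpansion_coeff_two_of_weight_sixteen (f : ModularForm 𝒮ℒ 16)
    (h0 : (qExpansion 1 f).coeff 0 = 1) (h1 : (qExpansion 1 f).coeff 1 = 0) :
    (qExpansion 1 f).coeff 2 = 146880 := by
  -- The q-coefficients of E₄⁴ and E₄E₆² are 4·240 = 960 and 240 - 2·504 = -768; the weights 4/9 and
  -- 5/9 sum to 1 and cancel them.
  let g : ModularForm 𝒮ℒ 16 := f - ((4 / 9 : ℂ) • E₄PowFour + (5 / 9 : ℂ) • E₄MulE₆Sq)
  have hg : qExpansion 1 g = qExpansion 1 f - ((4 / 9 : ℂ) • qExpansion 1 E₄ ^ 4 +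
      (5 / 9 : ℂ) • (qExpansion 1 E₄ * qExpansion 1 E₆ ^ 2)) := by
    have e1 := ModularForm.qExpansion_sub one_pos one_mem_strictPeriods_SL f
      ((4 / 9 : ℂ) • E₄PowFour + (5 / 9 : ℂ) • E₄MulE₆Sq)
    have e2 := ModularForm.qExpansion_add one_pos one_mem_strictPeriods_SL
      ((4 / 9 : ℂ) • E₄PowFour) ((5 / 9 : ℂ) • E₄MulE₆Sq)
    have e3 := ModularForm.qExpansion_smul one_pos one_mem_strictPeriods_SL (4 / 9) E₄PowFour
    have e4 := ModularForm.qExpansion_smul one_pos one_mem_strictPeriods_SL (5 / 9) E₄MulE₆Sq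
    rw [← qExpansion_E₄PowFour, ← qExpansion_E₄MulE₆Sq, ← e3, ← e4]
    exact e1.trans (congrArg _ e2)
  have hc : ∀ m, (qExpansion 1 g).coeff m = (qExpansion 1 f).coeff m -
      ((4 / 9 : ℂ) * (qExpansion 1 E₄ * qExpansion 1 E₄ * (qExpansion 1 E₄ * qExpansion 1 E₄)).coeff m
        + (5 / 9 : ℂ) * (qExpansion 1 E₄ * (qExpansion 1 E₆ * qExpansion 1 E₆)).coeff m) := by
    intro m
    rw [hg, map_sub, map_add, PowerSeries.coeff_smul, PowerSeries.coeff_smul]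
    ring_nf
  have hg0 : g = 0 := by
    -- In weight 16 the Sturm bound is 16/12 < 2, so vanishing of the coefficients of 1 and q
    -- suffices.
    refine sturm_bound_levelOne ?_
    refine lt_of_lt_of_le (b := ((2 : ℕ) : ℕ∞)) (by norm_num; decide)
      (PowerSeries.nat_le_order _ _ fun i hi => ?_)
    rw [hc]
    interval_cases i
    · rw [h0]
      norm_num [PowerSeries.coeff_mul, -PowerSeries.coeff_zero_eq_constantCoeff,
        E_qExpansion_coeff_zero _ ⟨2, rfl⟩,
        E_qExpansion_coeff_zero _ ⟨3, rfl⟩]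
    · rw [h1]
      norm_num [PowerSeries.coeff_mul, Finset.Nat.antidiagonal_succ, E₄_qExpansion_coeff_one,
        E₆_qExpansion_coeff_one, E_qExpansion_coeff_zero _ ⟨2, rfl⟩,
        E_qExpansion_coeff_zero _ ⟨3, rfl⟩]
  have h2 := hc 2
  rw [hg0] at h2
  have hz : (qExpansion 1 (0 : ModularForm 𝒮ℒ 16)).coeff 2 = 0 := by
    rw [FunLike.coe_zero, qExpansion_zero]; simp
  rw [hz] at h2
  rw [eq_comm, sub_eq_zero] at h2
  rw [h2]
  norm_num [PowerSeries.coeff_mul, Finset.Nat.antidiagonal_succ, E₄_qExpansion_coeff_one,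
        E₆_qExpansion_coeff_one, E_qExpansion_coeff_zero _ ⟨2, rfl⟩,
        E_qExpansion_coeff_zero _ ⟨3, rfl⟩, E₄_qExpansion_coeff_two, E₆_qExpansion_coeff_two]

end UnimodularLattice

/-! ### Vectors of norm 4, and norms of characteristic vectors modulo 8 -/

namespace UnimodularLattice

variable {V : Type*} [NormedAddCommGroup V] [InnerProductSpace ℝ V]

/-- `L` contains no vectors of norm `1` or `2`. -/
def IsRootless (L : Submodule ℤ V) : Prop :=
  ∀ x ∈ L, inner ℝ x x ≠ (1 : ℝ) ∧ inner ℝ x x ≠ (2 : ℝ)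

/-- `u` is a characteristic vector of `L`. -/
def IsCharacteristic (L : Submodule ℤ V) (u : V) : Prop :=
  u ∈ L ∧ ∀ x ∈ L, ∃ k : ℤ, inner ℝ u x - inner ℝ x x = 2 * (k : ℝ)

theorem card_norm_four_eq [FiniteDimensional ℝ V] {L : Submodule ℤ V} (hL : IsSelfDual L)
    (he : HasEvenNorms L) (hr : IsRootless L) (hdim : Module.finrank ℝ V = 32) :
    Nat.card {v : V // v ∈ L ∧ inner ℝ v v = (4 : ℝ)} = 146880 := by
  have h0 : Nat.card {x : L // ‖(x : V)‖ ^ 2 = 2 * (0 : ℕ)} = 1 := by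
    rw [Nat.card_eq_one_iff_unique]
    refine ⟨⟨fun a b => Subtype.ext (Subtype.ext ?_)⟩, ⟨0, by simp⟩⟩
    have ha := a.2
    have hb := b.2
    simp only [CharP.cast_eq_zero, mul_zero, ne_eq, OfNat.ofNat_ne_zero, not_false_eq_true,
      pow_eq_zero_iff, norm_eq_zero, ZeroMemClass.coe_eq_zero] at ha hb
    rw [ha, hb]
  have h1 : Nat.card {x : L // ‖(x : V)‖ ^ 2 = 2 * (1 : ℕ)} = 0 := by
    have : IsEmpty {x : L // ‖(x : V)‖ ^ 2 = 2 * (1 : ℕ)} := ⟨fun x => by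
      refine (hr x.1 x.1.2).2 ?_
      rw [real_inner_self_eq_norm_sq, x.2]; norm_num⟩
    exact Nat.card_of_isEmpty
  have h2 := qExpansion_coeff_two_of_weight_sixteen (thetaForm hL he hdim)
    (by rw [qExpansion_thetaForm_coeff, h0, Nat.cast_one])
    (by rw [qExpansion_thetaForm_coeff, h1, Nat.cast_zero])
  rw [qExpansion_thetaForm_coeff] at h2
  have h3 : Nat.card {x : L // ‖(x : V)‖ ^ 2 = 2 * (2 : ℕ)} = 146880 := by exact_mod_cast h2
  rw [← h3]
  refine Nat.card_congr
    { toFun := fun v => ⟨⟨v.1, v.2.1⟩, ?_⟩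
      invFun := fun x => ⟨x.1.1, x.1.2, ?_⟩
      left_inv := fun _ => rfl
      right_inv := fun _ => rfl }
  · change ‖v.1‖ ^ 2 = _
    rw [← real_inner_self_eq_norm_sq, v.2.2]; norm_num
  · rw [real_inner_self_eq_norm_sq, x.2]; norm_num

/-- Modulo 2, x ↦ (x, x) is additive on an integral lattice, so it is enough to represent it on a
basis; self-duality puts the representing vector in L. -/
theorem IsSelfDual.exists_isCharacteristic [FiniteDimensional ℝ V] {L : Submodule ℤ V}
    (hL : IsSelfDual L) : ∃ u, IsCharacteristic L u := by
  obtain ⟨b, hb⟩ := hL.exists_basis rfl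
  have hbL : ∀ i, b i ∈ L := fun i => by rw [hb]; exact Submodule.subset_span ⟨i, rfl⟩
  obtain ⟨u, hu⟩ := exists_inner_basis_eq b fun i => inner ℝ (b i) (b i)
  have huL : u ∈ L := (hL u).2 fun y hy => by
    rw [hb] at hy
    exact exists_inner_span_eq b u (fun i => by rw [hu]; exact hL.exists_inner_eq (hbL i) (hbL i)) hy
  refine ⟨u, huL, fun x hx => ?_⟩
  rw [hb] at hx
  induction hx using Submodule.span_induction with
  | mem x hx =>
    obtain ⟨i, rfl⟩ := hx
    exact ⟨0, by rw [hu]; simp⟩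
  | zero => exact ⟨0, by simp⟩
  | add x y hx hy h1 h2 =>
    obtain ⟨k, hk⟩ := h1
    obtain ⟨l, hl⟩ := h2
    obtain ⟨m, hm⟩ := hL.exists_inner_eq (show x ∈ L by rwa [hb]) (show y ∈ L by rwa [hb])
    refine ⟨k + l - m, ?_⟩
    rw [real_inner_add_add_self, inner_add_right, hm]
    push_cast
    linarith
  | smul a x hx h1 =>
    obtain ⟨k, hk⟩ := h1
    obtain ⟨m, hm⟩ := hL.exists_inner_eq (show x ∈ L by rwa [hb]) (show x ∈ L by rwa [hb])
    -- Here a² ≡ a mod 2 is used in the form that (a - 1)a is even.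
    obtain ⟨c, hc⟩ := Int.even_mul_succ_self (a - 1)
    refine ⟨a * k - c * m, ?_⟩
    have hc' : ((a : ℝ) - 1) * a = c + c := by
      have : (((a - 1) * (a - 1 + 1) : ℤ) : ℝ) = ((c + c : ℤ) : ℝ) := by rw [hc]
      push_cast at this
      linarith
    rw [← Int.cast_smul_eq_zsmul ℝ, inner_smul_right, inner_smul_right, inner_smul_left]
    simp only [conj_trivial]
    rw [hm] at hk ⊢
    push_cast
    linear_combination (a : ℝ) * hk - (m : ℝ) * hc'

theorem exp_pi_mul_I_mul_eq_of_even {s t : ℝ} {k : ℤ} (h : s - t = 2 * (k : ℝ)) :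
    Complex.exp (Real.pi * Complex.I * (s : ℂ)) = Complex.exp (Real.pi * Complex.I * (t : ℂ)) := by
  refine Complex.exp_eq_exp_iff_exists_int.2 ⟨k, ?_⟩
  have : (s : ℂ) = t + 2 * k := by
    have h' : s = t + 2 * k := by linarith
    rw [h']; push_cast; ring
  rw [this]; ring

/-- Characteristic vectors of a self-dual lattice of dimension `32` have norm divisible by `8`. -/
theorem IsCharacteristic.exists_norm_eq_eight_mul [FiniteDimensional ℝ V] {L : Submodule ℤ V}
    (hL : IsSelfDual L) (hdim : Module.finrank ℝ V = 32) {u : V} (hu : IsCharacteristic L u) :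
    ∃ k : ℤ, inner ℝ u u = 8 * (k : ℝ) := by
  -- Compare two computations of φ(τ + 1), where φ is the theta series of the coset u/2 + L. Modular
  -- relations give φ(τ), while the terms all acquire the factor exp(πi(u, u)/4). The series ψ
  -- carries the signs (-1)^(u, x) = (-1)^(x, x), so it is θ(τ + 1).
  set a : V := (1 / 2 : ℝ) • u with ha
  let φ : ℂ → ℂ := fun τ => ∑' x : L, Complex.exp (Real.pi * Complex.I * τ * (‖a + x‖ : ℂ) ^ 2)
  let ψ : ℂ → ℂ := fun τ => ∑' x : L, Complex.exp (Real.pi * Complex.I * τ * (‖(x : V)‖ : ℂ) ^ 2 +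
    2 * Real.pi * Complex.I * (inner ℝ (x : V) a : ℝ))
  have hxa : ∀ x : V, inner ℝ x a = inner ℝ u x / 2 := fun x => by
    rw [ha, inner_smul_right, real_inner_comm]; ring
  have hθψ : ∀ τ, theta L (τ + 1) = ψ τ := fun τ => by
    refine tsum_congr fun x => ?_
    obtain ⟨k, hk⟩ := hu.2 x x.2
    rw [real_inner_self_eq_norm_sq] at hk
    have h1 := exp_pi_mul_I_mul_eq_of_even hk
    rw [mul_add, mul_one, add_mul, Complex.exp_add, Complex.exp_add, hxa,
      ← Complex.ofReal_pow, ← h1]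
    congr 2
    push_cast
    ring
  have hψθ : ∀ τ, ψ (τ + 1) = theta L τ := fun τ => by
    refine tsum_congr fun x => ?_
    obtain ⟨k, hk⟩ := hu.2 x x.2
    obtain ⟨m, hm⟩ := hL.exists_inner_eq x.2 x.2
    have h0 : (inner ℝ u (x : V) + inner ℝ (x : V) (x : V)) - 0 = 2 * ((k + m : ℤ) : ℝ) := by
      push_cast; linarith
    have h1 := exp_pi_mul_I_mul_eq_of_even h0
    simp only [Complex.ofReal_zero, mul_zero, Complex.exp_zero] at h1
    rw [real_inner_self_eq_norm_sq] at h1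
    have h2 : (Real.pi * Complex.I * (τ + 1) * (‖(x : V)‖ : ℂ) ^ 2 +
        2 * Real.pi * Complex.I * (inner ℝ (x : V) a : ℝ)) =
        Real.pi * Complex.I * τ * (‖(x : V)‖ : ℂ) ^ 2 +
        Real.pi * Complex.I * ((inner ℝ u (x : V) + ‖(x : V)‖ ^ 2 : ℝ) : ℂ) := by
      rw [hxa]; push_cast; ring
    rw [h2, Complex.exp_add, h1, mul_one]
  have hθ2 : ∀ τ, theta L (τ + 2) = theta L τ := fun τ => by
    rw [← hψθ τ, ← hθψ (τ + 1)]; congr 1; ring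
  have hφψ : ∀ τ : ℂ, 0 < τ.im → φ τ = (τ ^ 16)⁻¹ * ψ (-1 / τ) := fun τ hτ => by
    have := hL.theta_inversion hτ a
    rwa [I_div_cpow_sixteen _ hdim] at this
  have hφT : ∀ τ : ℂ, 0 < τ.im → φ (τ + 1) = φ τ := fun τ hτ => by
    have hτ0 : τ ≠ 0 := fun h => by simp [h] at hτ
    have hτ' : 0 < (τ + 1).im := by simpa using hτ
    have hτ1 : τ + 1 ≠ 0 := fun h => by simp [h] at hτ'
    -- Chosen so that -1/ρ = -1/(τ + 1) + 1 and ρ + 2 = -1/τ + 1: the period 2 of θ and its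
    -- inversion at ρ link the two values of ψ that express φ(τ + 1) and φ(τ).
    set ρ : ℂ := -1 / τ - 1 with hρ
    have hρim : 0 < ρ.im := by simpa [hρ] using im_neg_one_div_pos hτ
    have hρ' : ρ = -(τ + 1) / τ := by rw [hρ]; field_simp; ring
    have hρ0 : ρ ≠ 0 := fun h => by simp [h] at hρim
    have h1 := hL.theta_neg_one_div hdim hρim
    have h2 : -1 / ρ = -1 / (τ + 1) + 1 := by rw [hρ']; field_simp; ring
    have h3 : ρ + 2 = -1 / τ + 1 := by rw [hρ]; ring
    rw [hφψ _ hτ', hφψ _ hτ, ← hθψ, ← hθψ, ← h2, ← h3, hθ2, h1, hρ']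
    field_simp
  -- All norms in the coset are congruent to (u, u)/4 mod 2, as (u, x) + (x, x) is even.
  have hζ : φ (Complex.I + 1) =
      Complex.exp (Real.pi * Complex.I * ((inner ℝ u u / 4 : ℝ) : ℂ)) * φ Complex.I := by
    change ∑' x : L, _ = _ * ∑' x : L, _
    rw [← tsum_mul_left]
    refine tsum_congr fun x => ?_
    obtain ⟨k, hk⟩ := hu.2 x x.2
    obtain ⟨m, hm⟩ := hL.exists_inner_eq x.2 x.2
    have hn : ‖a + (x : V)‖ ^ 2 = inner ℝ u u / 4 + inner ℝ u (x : V) + inner ℝ (x : V) (x : V) := by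
      rw [← real_inner_self_eq_norm_sq, real_inner_add_add_self, ha, inner_smul_left,
        inner_smul_right, inner_smul_left]
      simp only [conj_trivial]
      ring
    have h1 := exp_pi_mul_I_mul_eq_of_even (s := ‖a + (x : V)‖ ^ 2) (t := inner ℝ u u / 4)
      (k := k + m) (by rw [hn]; push_cast; linarith)
    rw [← h1, ← Complex.exp_add]
    congr 1
    push_cast
    ring
  have hφ0 : φ Complex.I ≠ 0 := by
    have h1 : ∀ x : L, Complex.exp (Real.pi * Complex.I * Complex.I * (‖a + (x : V)‖ : ℂ) ^ 2) =
        ((Real.exp (-Real.pi * ‖a + (x : V)‖ ^ 2) : ℝ) : ℂ) := fun x => by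
      push_cast
      congr 1
      rw [mul_assoc (Real.pi : ℂ), Complex.I_mul_I]
      ring
    change (∑' x : L, Complex.exp (Real.pi * Complex.I * Complex.I * (‖a + x‖ : ℂ) ^ 2)) ≠ 0
    simp_rw [h1]
    rw [← Complex.ofReal_tsum]
    have hs : Summable fun x : L => Real.exp (-Real.pi * ‖a + (x : V)‖ ^ 2) := by
      refine Summable.of_nonneg_of_le (fun _ => (Real.exp_pos _).le) (fun x => ?_)
        ((hL.summable_exp_neg_mul_norm_sq (c := Real.pi / 2) (by positivity)).mul_left
          (Real.exp (Real.pi * ‖a‖ ^ 2)))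
      rw [← Real.exp_add]
      refine Real.exp_le_exp.2 ?_
      have h3 : ‖(x : V)‖ ≤ ‖a + (x : V)‖ + ‖a‖ := by
        simpa using norm_sub_le (a + (x : V)) a
      have h4 : ‖(x : V)‖ ^ 2 ≤ 2 * ‖a + (x : V)‖ ^ 2 + 2 * ‖a‖ ^ 2 := by
        nlinarith [norm_nonneg (x : V), sq_nonneg (‖a + (x : V)‖ - ‖a‖)]
      nlinarith [Real.pi_pos]
    exact_mod_cast (hs.tsum_pos (fun _ => (Real.exp_pos _).le) 0 (Real.exp_pos _)).ne'
  rw [hφT _ (by simp)] at hζ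
  have h1 : Complex.exp (Real.pi * Complex.I * ((inner ℝ u u / 4 : ℝ) : ℂ)) = 1 :=
    mul_right_cancel₀ hφ0 (by rw [← hζ, one_mul])
  obtain ⟨k, hk⟩ := Complex.exp_eq_one_iff.1 h1
  refine ⟨k, ?_⟩
  have hpi : (Real.pi : ℂ) ≠ 0 := by exact_mod_cast Real.pi_ne_zero
  have h2 : ((inner ℝ u u / 4 : ℝ) : ℂ) = ((2 * k : ℝ) : ℂ) := by
    refine mul_left_cancel₀ (mul_ne_zero hpi Complex.I_ne_zero) ?_
    rw [hk]; push_cast; ring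
  have h3 : inner ℝ u u / 4 = 2 * (k : ℝ) := by exact_mod_cast h2
  linarith

end UnimodularLattice

/-! ### Slicing V ⊕ ℝ and gluing back -/

namespace UnimodularLattice

/-- The vector of the orthogonal sum `V ⊕ ℝ` with the given components. -/
abbrev pair {V : Type*} (y : V) (t : ℝ) : WithLp 2 (V × ℝ) := WithLp.toLp 2 (y, t)

theorem exists_eq_pair {V : Type*} (w : WithLp 2 (V × ℝ)) : ∃ y t, w = pair y t :=
  ⟨w.fst, w.snd, rfl⟩

theorem pair_congr {V : Type*} {y y' : V} {t t' : ℝ} (hy : y = y') (ht : t = t') :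
    pair y t = pair y' t' := by
  rw [hy, ht]

section Pair

variable {V : Type*} [NormedAddCommGroup V]

theorem pair_zero_zero : pair (0 : V) 0 = 0 := rfl

theorem pair_add (y y' : V) (t t' : ℝ) : pair y t + pair y' t' = pair (y + y') (t + t') := rfl

theorem pair_sub (y y' : V) (t t' : ℝ) : pair y t - pair y' t' = pair (y - y') (t - t') := rfl

theorem neg_pair (y : V) (t : ℝ) : -pair y t = pair (-y) (-t) := rfl

theorem zsmul_pair (m : ℤ) (y : V) (t : ℝ) : m • pair y t = pair (m • y) (m * t) := by
  rw [← zsmul_eq_mul]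
  rfl

/-- The orthogonal sum of `L` and `ℤ`. -/
def sumInt (L : Submodule ℤ V) : Submodule ℤ (WithLp 2 (V × ℝ)) where
  carrier := {w | w.fst ∈ L ∧ ∃ k : ℤ, w.snd = k}
  zero_mem' := ⟨L.zero_mem, 0, by simp⟩
  add_mem' := by
    rintro w w' ⟨h, k, hk⟩ ⟨h', k', hk'⟩
    exact ⟨L.add_mem h h', k + k', by simp [hk, hk']⟩
  smul_mem' := by
    rintro m w ⟨h, k, hk⟩
    exact ⟨L.smul_mem m h, m * k, by simp [hk]⟩

theorem pair_mem_sumInt {L : Submodule ℤ V} {y : V} {t : ℝ} :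
    pair y t ∈ sumInt L ↔ y ∈ L ∧ ∃ k : ℤ, t = k := Iff.rfl

/-- The lattice of all `y` such that `M` meets `y + ℤ e`, where `e` spans the second summand. -/
def slice (M : Submodule ℤ (WithLp 2 (V × ℝ))) : Submodule ℤ V where
  carrier := {y | ∃ k : ℤ, pair y k ∈ M}
  zero_mem' := ⟨0, by rw [Int.cast_zero, pair_zero_zero]; exact M.zero_mem⟩
  add_mem' := by
    rintro y y' ⟨k, hk⟩ ⟨k', hk'⟩
    exact ⟨k + k', by simpa [pair_add] using M.add_mem hk hk'⟩
  smul_mem' := by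
    rintro m y ⟨k, hk⟩
    refine ⟨m * k, ?_⟩
    have := M.smul_mem m hk
    rw [zsmul_pair] at this
    simpa using this

theorem mem_slice {M : Submodule ℤ (WithLp 2 (V × ℝ))} {y : V} :
    y ∈ slice M ↔ ∃ k : ℤ, pair y k ∈ M := Iff.rfl

theorem pair_add_two_mul_mem {M : Submodule ℤ (WithLp 2 (V × ℝ))} (h2 : pair 0 2 ∈ M) {y : V} {t : ℝ}
    (h : pair y t ∈ M) (j : ℤ) :
    pair y (t + 2 * j) ∈ M := by
  have := M.add_mem h (M.smul_mem j h2)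
  rw [zsmul_pair, pair_add] at this
  simpa [mul_comm] using this

end Pair

variable {V : Type*} [NormedAddCommGroup V] [InnerProductSpace ℝ V]

theorem inner_pair (y y' : V) (t t' : ℝ) :
    inner ℝ (pair y t) (pair y' t') = inner ℝ y y' + t * t' := by
  simp [WithLp.prod_inner_apply, mul_comm]

theorem IsSelfDual.sumInt {L : Submodule ℤ V} (hL : IsSelfDual L) : IsSelfDual (sumInt L) := by
  intro w
  obtain ⟨y, t, rfl⟩ := exists_eq_pair w
  constructor
  · rintro ⟨hy, k, hk⟩ w' ⟨hy', k', hk'⟩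
    obtain ⟨y', t', rfl⟩ := exists_eq_pair w'
    obtain ⟨l, hl⟩ := hL.exists_inner_eq hy hy'
    simp only [WithLp.toLp_fst, WithLp.toLp_snd] at hl hk hk'
    exact ⟨l + k * k', by rw [inner_pair, hl, hk, hk']; push_cast; ring⟩
  · intro h
    refine pair_mem_sumInt.2 ⟨(hL y).2 fun y' hy' => ?_, ?_⟩
    · obtain ⟨k, hk⟩ := h (pair y' 0) (pair_mem_sumInt.2 ⟨hy', 0, by simp⟩)
      exact ⟨k, by simpa [inner_pair] using hk⟩
    · obtain ⟨k, hk⟩ := h (pair 0 1) (pair_mem_sumInt.2 ⟨L.zero_mem, 1, by simp⟩)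
      exact ⟨k, by simpa [inner_pair] using hk⟩

/-- Since k² ≡ k mod 2, the vector 1 is characteristic for ℤ. This carries the congruence mod 8 from
dimension 32 to 31. -/
theorem IsCharacteristic.sumInt {L : Submodule ℤ V} {u : V} (hu : IsCharacteristic L u) :
    IsCharacteristic (sumInt L) (pair u 1) := by
  refine ⟨pair_mem_sumInt.2 ⟨hu.1, 1, by simp⟩, ?_⟩
  rintro w ⟨hy, k, hk⟩
  obtain ⟨y, t, rfl⟩ := exists_eq_pair w
  obtain ⟨l, hl⟩ := hu.2 y hy
  obtain ⟨c, hc⟩ := Int.even_mul_succ_self (k - 1)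
  simp only [WithLp.toLp_snd] at hk
  have hc' : ((k : ℝ) - 1) * k = c + c := by
    have : (((k - 1) * (k - 1 + 1) : ℤ) : ℝ) = ((c + c : ℤ) : ℝ) := by rw [hc]
    push_cast at this
    linarith
  exact ⟨l - c, by rw [inner_pair, inner_pair, hk]; push_cast; linarith⟩

theorem finrank_withLp_prod_real [FiniteDimensional ℝ V] :
    Module.finrank ℝ (WithLp 2 (V × ℝ)) = Module.finrank ℝ V + 1 := by
  rw [(WithLp.linearEquiv 2 ℝ (V × ℝ)).finrank_eq]; simp

/-- Characteristic vectors of a self-dual lattice of dimension `31` have norm `≡ -1 mod 8`. -/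
theorem IsCharacteristic.exists_norm_eq_eight_mul_sub_one [FiniteDimensional ℝ V]
    {L : Submodule ℤ V} (hL : IsSelfDual L) (hdim : Module.finrank ℝ V = 31) {u : V}
    (hu : IsCharacteristic L u) : ∃ k : ℤ, inner ℝ u u = 8 * (k : ℝ) - 1 := by
  obtain ⟨k, hk⟩ := hu.sumInt.exists_norm_eq_eight_mul hL.sumInt
    (by rw [finrank_withLp_prod_real, hdim])
  rw [inner_pair] at hk
  exact ⟨k, by linarith⟩

theorem IsCharacteristic.neg {L : Submodule ℤ V} {u : V} (hL : IsSelfDual L)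
    (hu : IsCharacteristic L u) : IsCharacteristic L (-u) := by
  refine ⟨L.neg_mem hu.1, fun x hx => ?_⟩
  obtain ⟨k, hk⟩ := hu.2 x hx
  obtain ⟨m, hm⟩ := hL.exists_inner_eq hx hx
  exact ⟨-k - m, by rw [inner_neg_left]; push_cast; linarith⟩

section Slice

variable {M : Submodule ℤ (WithLp 2 (V × ℝ))}

theorem IsSelfDual.exists_snd_eq (hM : IsSelfDual M) (h2 : pair 0 2 ∈ M) {y : V} {t : ℝ}
    (h : pair y t ∈ M) : (∃ k : ℤ, t = k) ∨ ∃ k : ℤ, t = k + 1 / 2 := by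
  obtain ⟨m, hm⟩ := hM.exists_inner_eq h h2
  rw [inner_pair, inner_zero_right, zero_add] at hm
  rcases Int.even_or_odd' m with ⟨k, rfl | rfl⟩
  · exact Or.inl ⟨k, by push_cast at hm; linarith⟩
  · exact Or.inr ⟨k, by push_cast at hm; linarith⟩

/-- An integer-valued additive condition that holds where the second coordinate is integral holds
everywhere as soon as it holds at one point where the second coordinate is not integral. -/
theorem forall_exists_inner_eq_of_half (hM : IsSelfDual M) (h2 : pair 0 2 ∈ M)
    {v : WithLp 2 (V × ℝ)}
    (h_integral : ∀ y ∈ slice M, ∀ k : ℤ, pair y k ∈ M → ∃ l : ℤ, inner ℝ v (pair y k) = (l : ℝ))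
    {y₀ : V} {k₀ : ℤ} (h₀ : pair y₀ (k₀ + 1 / 2 : ℝ) ∈ M)
    (hv : ∃ l : ℤ, inner ℝ v (pair y₀ (k₀ + 1 / 2 : ℝ)) = (l : ℝ)) : v ∈ M := by
  refine (hM v).2 fun w hw => ?_
  obtain ⟨y, t, rfl⟩ := exists_eq_pair w
  rcases hM.exists_snd_eq h2 hw with ⟨k, rfl⟩ | ⟨k, rfl⟩
  · exact h_integral y ⟨k, hw⟩ k hw
  · have h3 := M.sub_mem hw h₀
    rw [pair_sub, show (k + 1 / 2 - (k₀ + 1 / 2) : ℝ) = ((k - k₀ : ℤ) : ℝ) by push_cast; ring] at h3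
    obtain ⟨l, hl⟩ := h_integral _ ⟨_, h3⟩ _ h3
    obtain ⟨l', hl'⟩ := hv
    refine ⟨l + l', ?_⟩
    rw [show pair y (k + 1 / 2 : ℝ) = pair (y - y₀) ((k - k₀ : ℤ) : ℝ) + pair y₀ (k₀ + 1 / 2 : ℝ) by
      rw [pair_add]; exact pair_congr (by abel) (by push_cast; ring), inner_add_right, hl, hl']
    push_cast
    ring

/-- If the pairing with `v` is integral at the points with integral second coordinate, then one of
`v`, `v + e` lies in `M`. -/
theorem mem_or_add_mem_of_forall_exists_inner_eq (hM : IsSelfDual M) (h2 : pair 0 2 ∈ M)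
    {v : WithLp 2 (V × ℝ)}
    (h_integral : ∀ y ∈ slice M, ∀ k : ℤ, pair y k ∈ M → ∃ l : ℤ, inner ℝ v (pair y k) = (l : ℝ)) :
    v ∈ M ∨ v + pair 0 1 ∈ M := by
  by_cases hex : ∃ (y₀ : V) (k₀ : ℤ), pair y₀ (k₀ + 1 / 2 : ℝ) ∈ M
  · obtain ⟨y₀, k₀, h₀⟩ := hex
    -- Doubling a point with half-integral last coordinate makes that coordinate integral, so v
    -- pairs with the point in ½ℤ. If the value is not an integer, adding e changes it by k₀ + 1/2
    -- and repairs it.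
    have h4 := M.add_mem h₀ h₀
    rw [pair_add, show (k₀ + 1 / 2 + (k₀ + 1 / 2) : ℝ) = ((2 * k₀ + 1 : ℤ) : ℝ) by
      push_cast; ring] at h4
    obtain ⟨l, hl⟩ := h_integral _ ⟨_, h4⟩ _ h4
    have h5 : 2 * inner ℝ v (pair y₀ (k₀ + 1 / 2 : ℝ)) = (l : ℝ) := by
      rw [← hl, two_mul, ← inner_add_right, pair_add]
      congr 3
      push_cast
      ring
    rcases Int.even_or_odd' l with ⟨m, rfl | rfl⟩
    · left
      refine forall_exists_inner_eq_of_half hM h2 h_integral h₀ ⟨m, ?_⟩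
      push_cast at h5
      linarith
    · right
      refine forall_exists_inner_eq_of_half hM h2 (fun y hy k hk => ?_) h₀ ⟨m + k₀ + 1, ?_⟩
      · obtain ⟨l, hl⟩ := h_integral y hy k hk
        exact ⟨l + k, by rw [inner_add_left, hl, inner_pair]; simp⟩
      · rw [inner_add_left, inner_pair 0 y₀ 1]
        push_cast at h5 ⊢
        simp only [inner_zero_left, zero_add, one_mul]
        linarith
  · left
    refine (hM v).2 fun w hw => ?_
    obtain ⟨y, t, rfl⟩ := exists_eq_pair w
    rcases hM.exists_snd_eq h2 hw with ⟨k, rfl⟩ | ⟨k, rfl⟩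
    · exact h_integral y ⟨k, hw⟩ k hw
    · exact absurd ⟨y, k, hw⟩ hex

/-- If z pairs integrally with the slice, then (z, 0) does so with the integral part of M, and hence
(z, 0) or (z, 1) is in M. -/
theorem IsSelfDual.slice (hM : IsSelfDual M) (h2 : pair 0 2 ∈ M) : IsSelfDual (slice M) := by
  intro z
  constructor
  · rintro ⟨k, hk⟩ y ⟨k', hk'⟩
    obtain ⟨l, hl⟩ := hM.exists_inner_eq hk hk'
    rw [inner_pair] at hl
    exact ⟨l - k * k', by push_cast; linarith⟩
  · intro h
    rcases mem_or_add_mem_of_forall_exists_inner_eq hM h2 (v := pair z 0) (fun y hy k hk => by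
      obtain ⟨l, hl⟩ := h y hy
      exact ⟨l, by rw [inner_pair, hl]; simp⟩) with h3 | h3
    · exact ⟨0, by simpa using h3⟩
    · exact ⟨1, by simpa [pair_add] using h3⟩

/-- As (y, y) + k² is even, (u, y) ≡ (y, y) ≡ k² ≡ k mod 2. -/
theorem HasEvenNorms.exists_inner_sub_eq (he : HasEvenNorms M) {u : V}
    (hu : IsCharacteristic (UnimodularLattice.slice M) u) {y : V} {k : ℤ} (h : pair y k ∈ M) :
    ∃ j : ℤ, inner ℝ u y = k + 2 * (j : ℝ) := by
  obtain ⟨l, hl⟩ := hu.2 y ⟨k, h⟩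
  obtain ⟨m, hm⟩ := he _ h
  rw [inner_pair] at hm
  obtain ⟨c, hc⟩ := Int.even_mul_succ_self k
  have hc' : (k : ℝ) * (k + 1) = c + c := by exact_mod_cast hc
  exact ⟨l + m - c, by push_cast; linarith⟩

/-- One of the two halves of a characteristic vector of the slice lifts to `M`. -/
theorem half_mem_or_half_mem (hM : IsSelfDual M) (he : HasEvenNorms M) (h2 : pair 0 2 ∈ M) {u : V}
    (hu : IsCharacteristic (slice M) u) :
    pair ((1 / 2 : ℝ) • u) (1 / 2) ∈ M ∨ pair ((1 / 2 : ℝ) • -u) (1 / 2) ∈ M := by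
  -- This v pairs with (y, k) to ((u, y) - k)/2, an integer. The first alternative yields the half
  -- of -u after a sign change, the second the half of u.
  rcases mem_or_add_mem_of_forall_exists_inner_eq hM h2 (v := pair ((1 / 2 : ℝ) • u) (-1 / 2))
    (fun y hy k hk => by
      obtain ⟨j, hj⟩ := he.exists_inner_sub_eq hu hk
      exact ⟨j, by rw [inner_pair, inner_smul_left, hj]; simp; ring⟩) with h3 | h3
  · right
    have := M.neg_mem h3
    rw [neg_pair] at this
    rwa [pair_congr (smul_neg (1 / 2 : ℝ) u) (show (1 / 2 : ℝ) = -(-1 / 2) by norm_num)]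
  · left
    rw [pair_add] at h3
    rwa [pair_congr (add_zero _) (show (-1 / 2 + 1 : ℝ) = 1 / 2 by norm_num)] at h3

/-- Modulo (0, 2) the last coordinate is 0 or 1. With 0, y itself lies in M; with 1, norm 1 for y
would give a root of norm 2, and norm 2 an odd norm 3. -/
theorem IsRootless.slice (he : HasEvenNorms M) (hr : IsRootless M)
    (h2 : pair 0 2 ∈ M) : IsRootless (slice M) := by
  rintro y ⟨k, hk⟩
  rcases Int.even_or_odd' k with ⟨j, rfl | rfl⟩
  · have h3 := pair_add_two_mul_mem h2 hk (-j)
    rw [show (((2 * j : ℤ) : ℝ) + 2 * ((-j : ℤ) : ℝ)) = 0 by push_cast; ring] at h3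
    have h4 := hr _ h3
    rw [inner_pair] at h4
    simpa using h4
  · have h3 := pair_add_two_mul_mem h2 hk (-j)
    rw [show (((2 * j + 1 : ℤ) : ℝ) + 2 * ((-j : ℤ) : ℝ)) = 1 by push_cast; ring] at h3
    have h4 := hr _ h3
    obtain ⟨m, hm⟩ := he _ h3
    rw [inner_pair] at h4 hm
    refine ⟨fun h => h4.2 (by rw [h]; norm_num), fun h => ?_⟩
    rw [h] at hm
    have : (3 : ℤ) = 2 * m := by
      have h5 : (3 : ℝ) = 2 * m := by linarith
      exact_mod_cast h5
    omega

/-- Half of (±u, 1) would be a vector of M of norm (7 + 1)/4 = 2. -/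
theorem norm_ne_seven_of_isCharacteristic_slice (hM : IsSelfDual M) (he : HasEvenNorms M)
    (hr : IsRootless M) (h2 : pair 0 2 ∈ M) {u : V} (hu : IsCharacteristic (slice M) u) :
    inner ℝ u u ≠ (7 : ℝ) := by
  intro h7
  rcases half_mem_or_half_mem hM he h2 hu with h3 | h3 <;>
  · refine (hr _ h3).2 ?_
    rw [inner_pair, inner_smul_left, inner_smul_right]
    simp only [inner_neg_neg, h7, conj_trivial]
    norm_num

end Slice

/-- The lattice glued from the even part of `L ⊕ ℤ` by means of a characteristic vector. -/
def glue (L : Submodule ℤ V) (u : V) : Submodule ℤ (WithLp 2 (V × ℝ)) where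
  -- For u characteristic, m = 0 gives the (x, k) with k ≡ (u, x) ≡ (x, x) mod 2, the even
  -- sublattice of L ⊕ ℤ; m counts copies of half of (u, 1).
  carrier := {w | ∃ x ∈ L, ∃ m j : ℤ,
    w = pair (x + ((m : ℝ) / 2) • u) (inner ℝ u x + m / 2 + 2 * j)}
  zero_mem' := ⟨0, L.zero_mem, 0, 0, by simp [pair_zero_zero]⟩
  add_mem' := by
    rintro w w' ⟨x, hx, m, j, rfl⟩ ⟨x', hx', m', j', rfl⟩
    refine ⟨x + x', L.add_mem hx hx', m + m', j + j', ?_⟩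
    rw [pair_add, inner_add_right]
    exact pair_congr (by push_cast; module) (by push_cast; ring)
  smul_mem' := by
    rintro a w ⟨x, hx, m, j, rfl⟩
    refine ⟨a • x, L.smul_mem a hx, a * m, a * j, ?_⟩
    rw [zsmul_pair, ← Int.cast_smul_eq_zsmul ℝ, ← Int.cast_smul_eq_zsmul ℝ, inner_smul_right]
    exact pair_congr (by push_cast; module) (by push_cast; ring)

section Glue

variable {L : Submodule ℤ V} {u : V}

theorem pair_mem_glue {x : V} (hx : x ∈ L) (m j : ℤ) :
    pair (x + ((m : ℝ) / 2) • u) (inner ℝ u x + m / 2 + 2 * j) ∈ glue L u :=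
  ⟨x, hx, m, j, rfl⟩

theorem pair_zero_two_mem_glue : pair 0 2 ∈ glue L u := by
  simpa using pair_mem_glue (u := u) L.zero_mem 0 1

theorem half_mem_glue : pair ((1 / 2 : ℝ) • u) (1 / 2) ∈ glue L u := by
  simpa using pair_mem_glue (u := u) L.zero_mem 1 0

/-- The only visible fraction, ((u, u) + 1)/4, is the norm of the gluing vector; it is even when (u,
u) ≡ -1 mod 8. -/
theorem inner_glue (x x' : V) (m m' j j' : ℝ) :
    inner ℝ (pair (x + (m / 2) • u) (inner ℝ u x + m / 2 + 2 * j))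
      (pair (x' + (m' / 2) • u) (inner ℝ u x' + m' / 2 + 2 * j')) =
    inner ℝ x x' + inner ℝ u x * inner ℝ u x' + m' * inner ℝ u x + m * inner ℝ u x' +
      m * m' * ((inner ℝ u u + 1) / 4) + m' * j + m * j' +
      2 * j * inner ℝ u x' + 2 * j' * inner ℝ u x + 4 * j * j' := by
  rw [inner_pair]
  simp only [inner_add_left, inner_add_right, inner_smul_left, inner_smul_right, conj_trivial,
    real_inner_comm u]
  ring

theorem IsSelfDual.glue (hL : IsSelfDual L) (hu : u ∈ L)
    (h8 : ∃ k : ℤ, inner ℝ u u = 8 * (k : ℝ) - 1) : IsSelfDual (glue L u) := by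
  obtain ⟨c, hc⟩ := h8
  intro w
  constructor
  · rintro ⟨x, hx, m, j, rfl⟩ w' ⟨x', hx', m', j', rfl⟩
    obtain ⟨p, hp⟩ := hL.exists_inner_eq hx hx'
    obtain ⟨q, hq⟩ := hL.exists_inner_eq hu hx
    obtain ⟨r, hr⟩ := hL.exists_inner_eq hu hx'
    refine ⟨p + q * r + m' * q + m * r + m * m' * (2 * c) + m' * j + m * j' + 2 * j * r +
      2 * j' * q + 4 * j * j', ?_⟩
    rw [inner_glue, hp, hq, hr, hc]
    push_cast
    ring
  · obtain ⟨y, t, rfl⟩ := exists_eq_pair w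
    intro h
    -- Three kinds of test vectors recover the parameters: (0, 2) gives m = 2t, the (x, (u, x)) put
    -- the rest of y in L, and the gluing vector determines j.
    obtain ⟨m, hm⟩ := h _ pair_zero_two_mem_glue
    rw [inner_pair, inner_zero_right, zero_add] at hm
    have hy : y - ((m : ℝ) / 2) • u ∈ L := (hL _).2 fun x hx => by
      obtain ⟨l, hl⟩ := h _ (pair_mem_glue (u := u) hx 0 0)
      obtain ⟨q, hq⟩ := hL.exists_inner_eq hu hx
      rw [inner_pair] at hl
      simp only [Int.cast_zero, zero_div, zero_smul, add_zero, mul_zero, hq] at hl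
      refine ⟨l - m * q, ?_⟩
      rw [inner_sub_left, inner_smul_left, hq]
      simp only [conj_trivial]
      push_cast
      rw [← hm]
      linear_combination hl
    obtain ⟨l, hl⟩ := h _ half_mem_glue
    rw [inner_pair, inner_smul_right] at hl
    refine ⟨y - ((m : ℝ) / 2) • u, hy, m, 2 * m * c - l, ?_⟩
    refine pair_congr (by abel) ?_
    rw [inner_sub_right, inner_smul_right, real_inner_comm, hc]
    push_cast
    linear_combination hm - 2 * hl

theorem HasEvenNorms.glue (hL : IsSelfDual L) (hu : IsCharacteristic L u)
    (h8 : ∃ k : ℤ, inner ℝ u u = 8 * (k : ℝ) - 1) : HasEvenNorms (glue L u) := by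
  obtain ⟨c, hc⟩ := h8
  rintro w ⟨x, hx, m, j, rfl⟩
  obtain ⟨q, hq⟩ := hL.exists_inner_eq hu.1 hx
  obtain ⟨l, hl⟩ := hu.2 x hx
  obtain ⟨d, hd⟩ := Int.even_mul_succ_self q
  have hd' : (q : ℝ) * (q + 1) = d + d := by exact_mod_cast hd
  refine ⟨d - l + m * q + m * m * c + m * j + 2 * j * q + 2 * j * j, ?_⟩
  rw [inner_glue, hc, hq]
  rw [hq] at hl
  push_cast
  linear_combination hd' - hl

/-- An integral last coordinate forces m to be even, so (m/2)u stays in L. -/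
theorem slice_glue (hL : IsSelfDual L) (hu : u ∈ L) : slice (glue L u) = L := by
  ext y
  rw [mem_slice]
  constructor
  · rintro ⟨k, x, hx, m, j, h⟩
    obtain ⟨q, hq⟩ := hL.exists_inner_eq hu hx
    have h1 : y = x + ((m : ℝ) / 2) • u := congrArg WithLp.fst h
    have h2 : (k : ℝ) = inner ℝ u x + m / 2 + 2 * j := congrArg WithLp.snd h
    rw [hq] at h2
    have h3 : m = 2 * (k - q - 2 * j) := by
      have : (m : ℝ) = 2 * (k - q - 2 * j) := by linarith
      exact_mod_cast this
    rw [h1, h3, show (((2 * (k - q - 2 * j) : ℤ) : ℝ) / 2) = ((k - q - 2 * j : ℤ) : ℝ) by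
      push_cast; ring, Int.cast_smul_eq_zsmul]
    exact L.add_mem hx (L.smul_mem _ hu)
  · intro hy
    obtain ⟨q, hq⟩ := hL.exists_inner_eq hu hy
    exact ⟨q, by simpa [hq] using pair_mem_glue (u := u) hy 0 0⟩

/-- Evenness excludes norm 1. In norm 2, an even m leaves y in L with norm 1 or 2; an odd m makes
the last coordinate ±1/2, so 2y ∈ u + 2L is characteristic of norm 7. -/
theorem IsRootless.glue (hL : IsSelfDual L) (hr : IsRootless L) (hu : IsCharacteristic L u)
    (h7 : ∀ v, IsCharacteristic L v → inner ℝ v v ≠ (7 : ℝ))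
    (he : HasEvenNorms (glue L u)) : IsRootless (glue L u) := by
  intro w hw
  refine ⟨fun h => ?_, fun h => ?_⟩
  · obtain ⟨k, hk⟩ := he w hw
    have : (1 : ℤ) = 2 * k := by
      rw [h] at hk
      exact_mod_cast hk
    omega
  · obtain ⟨x, hx, m, j, rfl⟩ := hw
    obtain ⟨q, hq⟩ := hL.exists_inner_eq hu.1 hx
    set y := x + ((m : ℝ) / 2) • u with hy
    rw [inner_pair, hq] at h
    have hy0 : 0 ≤ inner ℝ y y := real_inner_self_nonneg
    rcases Int.even_or_odd' m with ⟨n, rfl | rfl⟩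
    · have hyL : y ∈ L := by
        rw [hy, show (((2 * n : ℤ) : ℝ) / 2) = (n : ℝ) by push_cast; ring, Int.cast_smul_eq_zsmul]
        exact L.add_mem hx (L.smul_mem _ hu.1)
      set s : ℤ := q + n + 2 * j with hs
      have hs' : (q : ℝ) + ((2 * n : ℤ) : ℝ) / 2 + 2 * j = s := by rw [hs]; push_cast; ring
      rw [hs'] at h
      have hs2 : s * s ≤ 2 := by
        have : (s : ℝ) * s ≤ 2 := by linarith
        exact_mod_cast this
      have hs3 : s = 0 ∨ s * s = 1 := by
        have h1 : s ≤ 1 := by nlinarith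
        have h2 : -1 ≤ s := by nlinarith
        interval_cases s <;> simp
      rcases hs3 with h0 | h1
      · exact (hr y hyL).2 (by rw [h0] at h; simpa using h)
      · refine (hr y hyL).1 ?_
        have : (s : ℝ) * s = 1 := by exact_mod_cast h1
        linarith
    · set s : ℤ := 2 * q + 2 * n + 4 * j + 1 with hs
      have hs' : (q : ℝ) + ((2 * n + 1 : ℤ) : ℝ) / 2 + 2 * j = s / 2 := by
        rw [hs]; push_cast; ring
      rw [hs'] at h
      have hs2 : s * s ≤ 8 := by
        have : (s : ℝ) * s ≤ 8 := by linarith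
        exact_mod_cast this
      have hs3 : s * s = 1 := by
        have h1 : s ≤ 2 := by nlinarith
        have h2 : -2 ≤ s := by nlinarith
        have h3 : s = 1 ∨ s = -1 := by omega
        rcases h3 with h3 | h3 <;> rw [h3] <;> norm_num
      have hs4 : (s : ℝ) * s = 1 := by exact_mod_cast hs3
      have hyc : IsCharacteristic L ((2 : ℝ) • y) := by
        have hy2 : (2 : ℝ) • y = u + (2 : ℤ) • (x + n • u) := by
          rw [hy, ← Int.cast_smul_eq_zsmul ℝ, ← Int.cast_smul_eq_zsmul ℝ]
          push_cast
          module
        have hz : x + n • u ∈ L := L.add_mem hx (L.smul_mem _ hu.1)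
        rw [hy2]
        refine ⟨L.add_mem hu.1 (L.smul_mem _ hz), fun v hv => ?_⟩
        obtain ⟨k, hk⟩ := hu.2 v hv
        obtain ⟨l, hl⟩ := hL.exists_inner_eq hz hv
        refine ⟨k + l, ?_⟩
        rw [inner_add_left, ← Int.cast_smul_eq_zsmul ℝ, inner_smul_left, hl]
        simp only [conj_trivial]
        push_cast
        linarith
      refine h7 _ hyc ?_
      rw [inner_smul_left, inner_smul_right]
      simp only [conj_trivial]
      linarith

/-- A self-dual lattice contained in another one is equal to it. -/
theorem IsSelfDual.eq_of_le {V : Type*} [NormedAddCommGroup V] [InnerProductSpace ℝ V]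
    {M N : Submodule ℤ V} (hM : IsSelfDual M) (hN : IsSelfDual N) (h : M ≤ N) : M = N :=
  le_antisymm h fun x hx => (hM x).2 fun _ hy => hN.exists_inner_eq hx (h hy)

theorem glue_le {M : Submodule ℤ (WithLp 2 (V × ℝ))} (he : HasEvenNorms M) (h2 : pair 0 2 ∈ M)
    (hu : IsCharacteristic (slice M) u) (hh : pair ((1 / 2 : ℝ) • u) (1 / 2) ∈ M) :
    glue (slice M) u ≤ M := by
  rintro w ⟨x, ⟨k, hk⟩, m, j, rfl⟩
  obtain ⟨i, hi⟩ := he.exists_inner_sub_eq hu hk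
  have h3 := M.add_mem (pair_add_two_mul_mem h2 hk (i + j)) (M.smul_mem m hh)
  rw [zsmul_pair, pair_add, ← Int.cast_smul_eq_zsmul ℝ] at h3
  rwa [pair_congr (show x + ((m : ℝ) / 2) • u = x + (m : ℝ) • (1 / 2 : ℝ) • u by module)
    (show inner ℝ u x + m / 2 + 2 * j = k + 2 * ((i + j : ℤ) : ℝ) + m * (1 / 2) by
      rw [hi]; push_cast; ring)]

/-- The gluing vectors for u and -u add up to (0, 1), which has odd norm. -/
theorem glue_ne_glue_neg (he : HasEvenNorms (glue L u)) : glue L u ≠ glue L (-u) := by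
  intro h
  have h1 : pair ((1 / 2 : ℝ) • -u) (1 / 2) ∈ glue L u := by
    rw [h]; exact half_mem_glue
  have h3 := (glue L u).add_mem half_mem_glue h1
  rw [pair_add] at h3
  obtain ⟨k, hk⟩ := he _ h3
  rw [inner_pair] at hk
  simp only [smul_neg, add_neg_cancel, inner_zero_right] at hk
  have : (1 : ℤ) = 2 * k := by
    have h5 : (1 : ℝ) = 2 * k := by linarith
    exact_mod_cast h5
  omega

end Glue

end UnimodularLattice

/-! ### Lattices under the orthogonal group -/

namespace UnimodularLattice

section Transport

variable {V W : Type*} [NormedAddCommGroup V] [InnerProductSpace ℝ V] [NormedAddCommGroup W]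
  [InnerProductSpace ℝ W]

/-- The image of a lattice under a linear isometry. -/
def transport (D : V ≃ₗᵢ[ℝ] W) (M : Submodule ℤ V) : Submodule ℤ W :=
  M.comap (D.symm.toLinearEquiv.toLinearMap.restrictScalars ℤ)

theorem mem_transport {D : V ≃ₗᵢ[ℝ] W} {M : Submodule ℤ V} {x : W} :
    x ∈ transport D M ↔ D.symm x ∈ M := Iff.rfl

theorem apply_mem_transport {D : V ≃ₗᵢ[ℝ] W} {M : Submodule ℤ V} {x : V} :
    D x ∈ transport D M ↔ x ∈ M := by
  rw [mem_transport, D.symm_apply_apply]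

theorem forall_mem_transport {D : V ≃ₗᵢ[ℝ] W} {M : Submodule ℤ V} {p : W → Prop} :
    (∀ x ∈ transport D M, p x) ↔ ∀ x ∈ M, p (D x) :=
  ⟨fun h x hx => h _ (apply_mem_transport.2 hx), fun h x hx => by
    simpa using h _ (mem_transport.1 hx)⟩

theorem IsSelfDual.transport {M : Submodule ℤ V} (hM : IsSelfDual M) (D : V ≃ₗᵢ[ℝ] W) :
    IsSelfDual (transport D M) := by
  intro x
  rw [mem_transport, hM, forall_mem_transport]
  refine forall₂_congr fun y _ => ?_
  rw [← D.inner_map_map (D.symm x), D.apply_symm_apply]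

theorem HasEvenNorms.transport {M : Submodule ℤ V} (hM : HasEvenNorms M) (D : V ≃ₗᵢ[ℝ] W) :
    HasEvenNorms (transport D M) := by
  refine forall_mem_transport.2 fun x hx => ?_
  rw [D.inner_map_map]
  exact hM x hx

theorem IsRootless.transport {M : Submodule ℤ V} (hM : IsRootless M) (D : V ≃ₗᵢ[ℝ] W) :
    IsRootless (transport D M) := by
  refine forall_mem_transport.2 fun x hx => ?_
  rw [D.inner_map_map]
  exact hM x hx

theorem IsCharacteristic.of_transport {M : Submodule ℤ V} {D : V ≃ₗᵢ[ℝ] W} {u : W}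
    (hu : IsCharacteristic (UnimodularLattice.transport D M) u) :
    IsCharacteristic M (D.symm u) := by
  refine ⟨hu.1, fun x hx => ?_⟩
  obtain ⟨k, hk⟩ := hu.2 (D x) (apply_mem_transport.2 hx)
  rw [D.inner_map_map, ← D.symm.inner_map_map u, D.symm_apply_apply] at hk
  exact ⟨k, hk⟩

/-- Even self-dual lattices without roots. -/
def IsEvenRootless (M : Submodule ℤ V) : Prop := IsSelfDual M ∧ HasEvenNorms M ∧ IsRootless M

/-- Self-dual lattices with neither roots nor characteristic vectors of norm `7`. -/
def IsRootlessNoSeven (L : Submodule ℤ V) : Prop :=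
  IsSelfDual L ∧ IsRootless L ∧ ∀ u, IsCharacteristic L u → inner ℝ u u ≠ (7 : ℝ)

theorem IsEvenRootless.transport {M : Submodule ℤ V} (hM : IsEvenRootless M) (D : V ≃ₗᵢ[ℝ] W) :
    IsEvenRootless (transport D M) :=
  ⟨hM.1.transport D, hM.2.1.transport D, hM.2.2.transport D⟩

theorem IsRootlessNoSeven.transport {M : Submodule ℤ V} (hM : IsRootlessNoSeven M)
    (D : V ≃ₗᵢ[ℝ] W) : IsRootlessNoSeven (transport D M) := by
  refine ⟨hM.1.transport D, hM.2.1.transport D, fun u hu => ?_⟩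
  have := hM.2.2 _ hu.of_transport
  rwa [D.symm.inner_map_map] at this

end Transport

section Action

variable {V : Type*} [NormedAddCommGroup V] [InnerProductSpace ℝ V]

/-- The orthogonal group acts on the space. -/
instance isometryAction : MulAction (V ≃ₗᵢ[ℝ] V) V where
  smul g x := g x
  one_smul _ := rfl
  mul_smul _ _ _ := rfl

/-- The orthogonal group acts on the lattices. -/
instance latticeAction : MulAction (V ≃ₗᵢ[ℝ] V) (Submodule ℤ V) where
  smul g M := transport g M
  one_smul _ := rfl
  mul_smul _ _ _ := rfl

theorem mem_lattice_smul {g : V ≃ₗᵢ[ℝ] V} {M : Submodule ℤ V} {x : V} :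
    x ∈ g • M ↔ g.symm x ∈ M := Iff.rfl

theorem image_eq_iff_smul_eq {g : V ≃ₗᵢ[ℝ] V} {L M : Submodule ℤ V} :
    g '' (L : Set V) = (M : Set V) ↔ g • L = M := by
  have : g '' (L : Set V) = ((g • L : Submodule ℤ V) : Set V) := by
    ext x
    refine ⟨?_, fun hx => ⟨g.symm x, hx, g.apply_symm_apply x⟩⟩
    rintro ⟨y, hy, rfl⟩
    exact apply_mem_transport.2 hy
  rw [this, SetLike.coe_set_eq]

/-- An automorphism is determined by the images of a basis, and each image is one of finitely many
lattice vectors of bounded length. -/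
theorem finite_stabilizer [FiniteDimensional ℝ V] {L : Submodule ℤ V} (hL : IsSelfDual L) :
    Finite (MulAction.stabilizer (V ≃ₗᵢ[ℝ] V) L) := by
  obtain ⟨b, hb⟩ := hL.exists_basis rfl
  have hbL : ∀ i, b i ∈ L := fun i => by rw [hb]; exact Submodule.subset_span ⟨i, rfl⟩
  have hfin : ∀ i, Finite {x | x ∈ L ∧ ‖x‖ ≤ ‖b i‖} := fun i => hL.finite_norm_le _
  let F : MulAction.stabilizer (V ≃ₗᵢ[ℝ] V) L → ∀ i, {x | x ∈ L ∧ ‖x‖ ≤ ‖b i‖} :=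
    fun g i => ⟨g.1 (b i), by
      have h : g.1 • L = L := g.2
      exact h.le (apply_mem_transport.2 (hbL i)), (g.1.norm_map _).le⟩
  refine Finite.of_injective F fun g g' h => Subtype.ext ?_
  refine LinearIsometryEquiv.toLinearEquiv_injective (b.ext' fun i => ?_)
  exact congrArg Subtype.val (congrFun h i)

/-- The lattices satisfying an invariant property, with the action of the orthogonal group. -/
def latticeFamily (P : Submodule ℤ V → Prop)
    (hP : ∀ M, P M → ∀ g : V ≃ₗᵢ[ℝ] V, P (transport g M)) :
    SubMulAction (V ≃ₗᵢ[ℝ] V) (Submodule ℤ V) where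
  carrier := {M | P M}
  smul_mem' g _ hM := hP _ hM g

/-- The pairs of an even rootless lattice and a vector of norm `4` in it. -/
def pointedFamily (V : Type*) [NormedAddCommGroup V] [InnerProductSpace ℝ V] :
    SubMulAction (V ≃ₗᵢ[ℝ] V) (Submodule ℤ V × V) where
  carrier := {p | IsEvenRootless p.1 ∧ p.2 ∈ p.1 ∧ inner ℝ p.2 p.2 = (4 : ℝ)}
  smul_mem' g p hp := ⟨hp.1.transport g, apply_mem_transport.2 hp.2.1, by
    change inner ℝ (g p.2) (g p.2) = (4 : ℝ)
    rw [g.inner_map_map]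
    exact hp.2.2⟩

/-- The even rootless lattices as a set with an action of the orthogonal group. -/
abbrev evenFamily (V : Type*) [NormedAddCommGroup V] [InnerProductSpace ℝ V] :
    SubMulAction (V ≃ₗᵢ[ℝ] V) (Submodule ℤ V) :=
  latticeFamily IsEvenRootless fun _ h g => h.transport g

/-- The lattices with `IsRootlessNoSeven` as a set with an action of the orthogonal group. -/
abbrev noSevenFamily (V : Type*) [NormedAddCommGroup V] [InnerProductSpace ℝ V] :
    SubMulAction (V ≃ₗᵢ[ℝ] V) (Submodule ℤ V) :=
  latticeFamily IsRootlessNoSeven fun _ h g => h.transport g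

theorem finite_stabilizer_latticeFamily [FiniteDimensional ℝ V] {P : Submodule ℤ V → Prop}
    {hP : ∀ M, P M → ∀ g : V ≃ₗᵢ[ℝ] V, P (transport g M)} (hS : ∀ M, P M → IsSelfDual M)
    (M : latticeFamily P hP) : Finite (MulAction.stabilizer (V ≃ₗᵢ[ℝ] V) M) := by
  have := finite_stabilizer (hS M.1 M.2)
  refine Finite.of_injective (fun g : MulAction.stabilizer (V ≃ₗᵢ[ℝ] V) M =>
    (⟨g.1, congrArg Subtype.val g.2⟩ : MulAction.stabilizer (V ≃ₗᵢ[ℝ] V) M.1)) fun g g' h => ?_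
  exact Subtype.ext (congrArg (fun k : MulAction.stabilizer (V ≃ₗᵢ[ℝ] V) M.1 => k.1) h)

/-- Equivalence classes are orbits and automorphism groups are stabilizers. -/
theorem mass_eq_mass_latticeFamily {n : ℕ} (P : Submodule ℤ (E n) → Prop)
    (hP : ∀ M, P M → ∀ g : E n ≃ₗᵢ[ℝ] E n, P (transport g M)) :
    mass P = MulAction.mass (E n ≃ₗᵢ[ℝ] E n) (latticeFamily P hP) := by
  let X := latticeFamily P hP
  let e : Quotient (equivSetoid P) ≃ MulAction.orbitRel.Quotient (E n ≃ₗᵢ[ℝ] E n) X :=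
    Quotient.congr (Equiv.refl _) fun L M => by
      constructor
      · rintro ⟨g, hg⟩
        exact (MulAction.orbitRel _ X).symm
          ⟨g, Subtype.ext (image_eq_iff_smul_eq.1 hg)⟩
      · intro h
        obtain ⟨g, hg⟩ := (MulAction.orbitRel _ X).symm h
        exact ⟨g, image_eq_iff_smul_eq.2 (congrArg Subtype.val hg)⟩
  unfold mass MulAction.mass
  rw [← e.tsum_eq]
  refine tsum_congr fun c => ?_
  let x : X := ⟨c.out.1, c.out.2⟩
  have h1 : e c = Quotient.mk (MulAction.orbitRel (E n ≃ₗᵢ[ℝ] E n) X) x := by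
    conv_lhs => rw [← Quotient.out_eq c]
    rfl
  rw [h1, MulAction.card_stabilizer_out x]
  congr 2
  refine Nat.card_congr (Equiv.subtypeEquivRight fun g => ?_)
  refine image_eq_iff_smul_eq.trans ⟨fun h => Subtype.ext h, fun h => congrArg Subtype.val h⟩

theorem massEvenNoRoots_eq (n : ℕ) :
    massEvenNoRoots n = MulAction.mass (E n ≃ₗᵢ[ℝ] E n) (evenFamily (E n)) := by
  rw [← mass_eq_mass_latticeFamily]
  unfold massEvenNoRoots
  congr 1
  ext L
  rw [isUnimodular_iff_isSelfDual]
  refine and_congr_right fun _ => and_congr Iff.rfl ?_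
  rw [Set.eq_empty_iff_forall_notMem]
  simp [roots, IsRootless]

theorem mass_noSeven_eq (n : ℕ) :
    mass (fun L : Submodule ℤ (E n) => IsUnimodular L ∧ roots L = ∅ ∧
      ¬ ∃ u, IsParityVector L u ∧ inner ℝ u u = (7 : ℝ)) =
    MulAction.mass (E n ≃ₗᵢ[ℝ] E n) (noSevenFamily (E n)) := by
  rw [← mass_eq_mass_latticeFamily]
  congr 1
  ext L
  rw [isUnimodular_iff_isSelfDual]
  refine and_congr_right fun _ => and_congr ?_ ?_
  · rw [Set.eq_empty_iff_forall_notMem]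
    simp [roots, IsRootless]
  · rw [not_exists]
    exact forall_congr' fun u => not_and

/-- Conjugation by D; needed because the 32-dimensional space appears both as `E 32` and as the sum
of `E 31` and ℝ. -/
theorem mass_evenFamily_congr {W : Type*} [NormedAddCommGroup W] [InnerProductSpace ℝ W]
    (D : V ≃ₗᵢ[ℝ] W) : MulAction.mass (V ≃ₗᵢ[ℝ] V) (evenFamily V) =
      MulAction.mass (W ≃ₗᵢ[ℝ] W) (evenFamily W) := by
  let ι : (V ≃ₗᵢ[ℝ] V) →* (W ≃ₗᵢ[ℝ] W) :=
    { toFun := fun g => (D.symm.trans g).trans D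
      map_one' := by ext x; simp
      map_mul' := fun g h => by ext x; simp }
  have hι : ∀ g x, ι g x = D (g (D.symm x)) := fun _ _ => rfl
  refine MulAction.mass_eq_of_fullyFaithful ι ?_
    (fun M => ⟨transport D M.1, M.2.transport D⟩) ?_ ?_ ?_ ?_
  · intro g h hgh
    ext x
    have := DFunLike.congr_fun hgh (D x)
    simpa [hι] using this
  · intro g M
    refine Subtype.ext ?_
    ext x
    change g.symm (D.symm x) ∈ M.1 ↔ D.symm (D (g.symm (D.symm x))) ∈ M.1
    rw [D.symm_apply_apply]
  · intro M N h
    refine Subtype.ext ?_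
    ext x
    have h1 : transport D M.1 = transport D N.1 := congrArg Subtype.val h
    rw [← apply_mem_transport (D := D), h1, apply_mem_transport]
  · intro g _ _ _
    refine ⟨(D.trans g).trans D.symm, ?_⟩
    ext x
    simp [hι]
  · intro M
    refine ⟨1, ⟨transport D.symm M.1, M.2.transport D.symm⟩, ?_⟩
    rw [one_smul]
    refine Subtype.ext ?_
    ext x
    change D (D.symm x) ∈ M.1 ↔ x ∈ M.1
    rw [D.apply_symm_apply]

theorem mass_pointedFamily [FiniteDimensional ℝ V] (hdim : Module.finrank ℝ V = 32) :
    MulAction.mass (V ≃ₗᵢ[ℝ] V) (pointedFamily V) =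
      (146880 : ℕ) * MulAction.mass (V ≃ₗᵢ[ℝ] V) (evenFamily V) := by
  refine MulAction.mass_eq_mul_of_card_fiber
    (fun p : pointedFamily V => (⟨p.1.1, p.2.1⟩ : evenFamily V)) (fun g p => rfl)
    (finite_stabilizer_latticeFamily fun _ h => h.1) 146880 (by norm_num) fun M => ?_
  rw [← card_norm_four_eq M.2.1 M.2.2.1 M.2.2.2 hdim]
  exact Nat.card_congr
    { toFun := fun p => ⟨p.1.1.2, by
        have h : p.1.1.1 = M.1 := congrArg Subtype.val p.2
        rw [← h]; exact p.1.2.2⟩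
      invFun := fun v => ⟨⟨(M.1, v.1), M.2, v.2⟩, rfl⟩
      left_inv := fun p => Subtype.ext (Subtype.ext
        (Prod.ext (congrArg Subtype.val p.2).symm rfl))
      right_inv := fun _ => rfl }

end Action

/-! ### Passing from pairs (M, v) to lattices of dimension 31 -/

section Glued

variable {V : Type*} [NormedAddCommGroup V] [InnerProductSpace ℝ V]

/-- The isometries of `V` extended by the identity to `V ⊕ ℝ`. -/
noncomputable def extendIsometry (V : Type*) [NormedAddCommGroup V] [InnerProductSpace ℝ V] :
    (V ≃ₗᵢ[ℝ] V) →* (WithLp 2 (V × ℝ) ≃ₗᵢ[ℝ] WithLp 2 (V × ℝ)) where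
  toFun h := LinearIsometryEquiv.withLpProdCongr 2 h (LinearIsometryEquiv.refl ℝ ℝ)
  map_one' := rfl
  map_mul' _ _ := rfl

theorem extendIsometry_pair (h : V ≃ₗᵢ[ℝ] V) (y : V) (t : ℝ) :
    extendIsometry V h (pair y t) = pair (h y) t := rfl

theorem extendIsometry_symm_pair (h : V ≃ₗᵢ[ℝ] V) (y : V) (t : ℝ) :
    (extendIsometry V h).symm (pair y t) = pair (h.symm y) t := rfl

/-- The even rootless lattices in `V ⊕ ℝ` containing `(0, 2)`. -/
def GluedFamily (V : Type*) [NormedAddCommGroup V] [InnerProductSpace ℝ V] : Type _ :=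
  {M : Submodule ℤ (WithLp 2 (V × ℝ)) // IsEvenRootless M ∧ pair 0 2 ∈ M}

noncomputable instance gluedAction : MulAction (V ≃ₗᵢ[ℝ] V) (GluedFamily V) where
  smul h M := ⟨extendIsometry V h • M.1, M.2.1.transport _, by
    rw [mem_lattice_smul, extendIsometry_symm_pair, map_zero]
    exact M.2.2⟩
  one_smul _ := rfl
  mul_smul _ _ _ := rfl

/-- An isometry fixing (0, 2) preserves its orthogonal complement V, and its restriction to V
determines it. -/
theorem exists_extendIsometry_eq [FiniteDimensional ℝ V]
    (g : WithLp 2 (V × ℝ) ≃ₗᵢ[ℝ] WithLp 2 (V × ℝ)) (hg : g (pair 0 2) = pair 0 2) :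
    ∃ h, extendIsometry V h = g := by
  have hsnd : ∀ y : V, (g (pair y 0)).snd = 0 := fun y => by
    have h1 := g.inner_map_map (pair y 0) (pair 0 2)
    obtain ⟨y', t', h2⟩ := exists_eq_pair (g (pair y 0))
    rw [hg, h2, inner_pair, inner_pair] at h1
    rw [h2]
    simpa using h1
  have hpair : ∀ y : V, g (pair y 0) = pair (g (pair y 0)).fst 0 := fun y => by
    obtain ⟨y', t', h2⟩ := exists_eq_pair (g (pair y 0))
    have h3 := hsnd y
    rw [h2] at h3 ⊢
    exact pair_congr rfl h3
  let f : V →ₗᵢ[ℝ] V :=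
    { toFun := fun y => (g (pair y 0)).fst
      map_add' := fun y z => by
        have : pair (y + z) 0 = pair y 0 + pair z 0 := by rw [pair_add, add_zero]
        rw [this, map_add]; rfl
      map_smul' := fun c y => by
        have : pair (c • y) 0 = c • pair y 0 := by
          rw [← WithLp.toLp_smul, Prod.smul_mk, smul_zero]
        rw [this, map_smul]; rfl
      norm_map' := fun y => by
        have h1 := g.norm_map (pair y 0)
        rw [hpair y] at h1
        have h2 : ∀ z : V, ‖pair z 0‖ = ‖z‖ := fun z => by
          rw [← sq_eq_sq₀ (norm_nonneg _) (norm_nonneg _), ← real_inner_self_eq_norm_sq,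
            ← real_inner_self_eq_norm_sq, inner_pair]
          simp
        rw [h2, h2] at h1
        exact h1 }
  refine ⟨f.toLinearIsometryEquiv rfl, ?_⟩
  ext1 w
  obtain ⟨y, t, rfl⟩ := exists_eq_pair w
  have hw : pair y t = pair y 0 + (t / 2) • pair 0 2 := by
    rw [← WithLp.toLp_smul, Prod.smul_mk, pair_add]
    exact pair_congr (by simp) (by simp)
  rw [extendIsometry_pair]
  conv_rhs => rw [hw, map_add, map_smul, hg, hpair]
  rw [← WithLp.toLp_smul, Prod.smul_mk, pair_add]
  exact pair_congr (by simp [f]) (by simp)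

/-- Every vector of norm 4 can be moved to (0, 2), and the stabilizer of (0, 2) is the orthogonal
group of V. -/
theorem mass_gluedFamily [FiniteDimensional ℝ V] :
    MulAction.mass (V ≃ₗᵢ[ℝ] V) (GluedFamily V) =
      MulAction.mass (WithLp 2 (V × ℝ) ≃ₗᵢ[ℝ] WithLp 2 (V × ℝ))
        (pointedFamily (WithLp 2 (V × ℝ))) := by
  have h4 : inner ℝ (pair (0 : V) 2) (pair (0 : V) 2) = (4 : ℝ) := by
    rw [inner_pair, inner_zero_left]; norm_num
  refine MulAction.mass_eq_of_fullyFaithful (extendIsometry V) ?_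
    (fun M => ⟨(M.1, pair 0 2), M.2.1, M.2.2, h4⟩) ?_ ?_ ?_ ?_
  · intro h h' hh
    ext y
    have := DFunLike.congr_fun hh (pair y 0)
    exact congrArg WithLp.fst this
  · intro h M
    refine Subtype.ext (Prod.ext rfl ?_)
    change pair (0 : V) 2 = extendIsometry V h (pair 0 2)
    rw [extendIsometry_pair, map_zero]
  · intro M M' h
    exact Subtype.ext (congrArg (fun p => p.1.1) h)
  · intro g M M' h
    exact exists_extendIsometry_eq g (congrArg (fun p => p.1.2) h)
  · rintro ⟨⟨M, v⟩, hM, hv, hv4⟩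
    have hn : ‖pair (0 : V) 2‖ = ‖v‖ := by
      rw [← sq_eq_sq₀ (norm_nonneg _) (norm_nonneg _), ← real_inner_self_eq_norm_sq,
        ← real_inner_self_eq_norm_sq, h4]
      exact hv4.symm
    let g : WithLp 2 (V × ℝ) ≃ₗᵢ[ℝ] WithLp 2 (V × ℝ) :=
      -- Vectors of equal length are exchanged by the reflection in the hyperplane orthogonal to
      -- their difference.
      (Submodule.span ℝ {pair (0 : V) 2 - v})ᗮ.reflection
    have hg : g (pair 0 2) = v := Submodule.reflection_sub hn
    refine ⟨g, ⟨transport g.symm M, hM.transport _, ?_⟩, Subtype.ext (Prod.ext ?_ hg)⟩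
    · rw [mem_transport, LinearIsometryEquiv.symm_symm, hg]
      exact hv
    · ext x
      change g (g.symm x) ∈ M ↔ x ∈ M
      rw [g.apply_symm_apply]

theorem slice_smul (h : V ≃ₗᵢ[ℝ] V) (M : Submodule ℤ (WithLp 2 (V × ℝ))) :
    slice (extendIsometry V h • M) = h • slice M := by
  ext y
  rw [mem_slice, mem_lattice_smul, mem_slice]
  refine exists_congr fun k => ?_
  rw [mem_lattice_smul, extendIsometry_symm_pair]

/-- The fibre is `glue L u`, `glue L (-u)` for any characteristic u: M contains one of the two
gluing vectors, hence one of these lattices, and nested self-dual lattices coincide. -/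
theorem card_glued_fiber [FiniteDimensional ℝ V] (hdim : Module.finrank ℝ V = 31)
    {L : Submodule ℤ V} (hL : IsRootlessNoSeven L) :
    Nat.card {M : GluedFamily V // slice M.1 = L} = 2 := by
  obtain ⟨u, hu⟩ := hL.1.exists_isCharacteristic
  have hglue : ∀ v, IsCharacteristic L v → IsEvenRootless (glue L v) := fun v hv => by
    have h8 := hv.exists_norm_eq_eight_mul_sub_one hL.1 hdim
    have he := HasEvenNorms.glue hL.1 hv h8
    exact ⟨hL.1.glue hv.1 h8, he, hL.2.1.glue hL.1 hv hL.2.2 he⟩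
  let F : ∀ v, IsCharacteristic L v → {M : GluedFamily V // slice M.1 = L} := fun v hv =>
    ⟨⟨glue L v, hglue v hv, pair_zero_two_mem_glue⟩, slice_glue hL.1 hv.1⟩
  have hu' := hu.neg hL.1
  rw [Nat.card_eq_two_iff]
  refine ⟨F u hu, F (-u) hu', fun h => ?_, Set.eq_univ_of_forall fun M => ?_⟩
  · exact glue_ne_glue_neg (hglue u hu).2.1 (congrArg (fun M => M.1.1) h)
  · have hM := M.1.2.1
    have h2 := M.1.2.2
    have hs := M.2
    have key : ∀ v (hv : IsCharacteristic L v),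
        pair ((1 / 2 : ℝ) • v) (1 / 2) ∈ M.1.1 → M = F v hv := fun v hv hh => by
      refine Subtype.ext (Subtype.ext ?_)
      refine (IsSelfDual.eq_of_le (hglue v hv).1 hM.1 ?_).symm
      have hv' : IsCharacteristic (slice M.1.1) v := by rw [hs]; exact hv
      have := glue_le hM.2.1 h2 hv' hh
      rwa [hs] at this
    have hus : IsCharacteristic (slice M.1.1) u := by rw [hs]; exact hu
    rcases half_mem_or_half_mem hM.1 hM.2.1 h2 hus with h3 | h3
    · exact Or.inl (key u hu h3)
    · exact Or.inr (key (-u) hu' h3)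

theorem mass_gluedFamily_eq_two_mul [FiniteDimensional ℝ V] (hdim : Module.finrank ℝ V = 31) :
    MulAction.mass (V ≃ₗᵢ[ℝ] V) (GluedFamily V) =
      (2 : ℕ) * MulAction.mass (V ≃ₗᵢ[ℝ] V) (noSevenFamily V) := by
  refine MulAction.mass_eq_mul_of_card_fiber
    (fun M : GluedFamily V => (⟨slice M.1, M.2.1.1.slice M.2.2,
      M.2.1.2.2.slice M.2.1.2.1 M.2.2, fun _ hu => norm_ne_seven_of_isCharacteristic_slice
        M.2.1.1 M.2.1.2.1 M.2.1.2.2 M.2.2 hu⟩ : noSevenFamily V))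
    (fun h M => Subtype.ext (slice_smul h M.1))
    (finite_stabilizer_latticeFamily fun _ h => h.1) 2 two_ne_zero fun L => ?_
  rw [← card_glued_fiber hdim L.2]
  exact Nat.card_congr (Equiv.subtypeEquivRight fun M =>
    ⟨fun h => congrArg Subtype.val h, fun h => Subtype.ext h⟩)

end Glued

/-! ### Equating the two counts -/

theorem two_mul_mass_noSevenFamily :
    2 * MulAction.mass (E 31 ≃ₗᵢ[ℝ] E 31) (noSevenFamily (E 31)) =
      146880 * MulAction.mass (E 32 ≃ₗᵢ[ℝ] E 32) (evenFamily (E 32)) := by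
  have hfr : Module.finrank ℝ (WithLp 2 (E 31 × ℝ)) = 32 := by
    rw [finrank_withLp_prod_real]; simp
  let D : E 32 ≃ₗᵢ[ℝ] WithLp 2 (E 31 × ℝ) :=
    ((stdOrthonormalBasis ℝ _).reindex (finCongr hfr)).repr.symm
  have h := mass_gluedFamily_eq_two_mul (V := E 31) (by simp)
  rw [mass_gluedFamily, mass_pointedFamily hfr, ← mass_evenFamily_congr D] at h
  exact_mod_cast h.symm

end UnimodularLattice

theorem proposition12 :
    UnimodularLattice.mass (fun L : Submodule ℤ (UnimodularLattice.E 31) =>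
        UnimodularLattice.IsUnimodular L ∧ UnimodularLattice.roots L = ∅ ∧
          ¬ ∃ u, UnimodularLattice.IsParityVector L u ∧ inner ℝ u u = (7 : ℝ)) =
      (146880 / 2) * UnimodularLattice.massEvenNoRoots 32 := by
  rw [UnimodularLattice.mass_noSeven_eq, UnimodularLattice.massEvenNoRoots_eq,
    ENNReal.div_eq_inv_mul, mul_assoc, ← UnimodularLattice.two_mul_mass_noSevenFamily,
    ← mul_assoc, ENNReal.inv_mul_cancel two_ne_zero ENNReal.ofNat_ne_top, one_mul]
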